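/- **Lemma 4.7 (with its improvement Lemma 4.8).** Let $n\ge 2$ and $0<\delta<1$, and let $$U_\delta=\{(x,y,\kappa)\in\mathbb R^2\times\mathbb R^{n-2}:\ \delta^2<x^2+y^2<\delta\}$$ be the neck region, with the metric $\tilde g_\delta$ induced by $dx^2+dy^2+du^2+dv^2+d\kappa_1^2+\dots+d\kappa_{n-2}^2$ on the graph $u=\frac{\delta^2x}{2(x^2+y^2)}$, $v=\frac{\delta^2y}{2(x^2+y^2)}$ (that is, $z_1\overline{z_2}=\frac{\delta^2}{2}$ with $z_1=x+iy$, $z_2=u+iv$). Explicitly, $$\tilde g_\delta=\Big(1+\frac{\delta^4}{4(x^2+y^2)^2}\Big)(dx^2+dy^2)+d\kappa_1^2+\dots+d\kappa_{n-2}^2 .$$ Let $d\mathrm{vol}_\delta$ be its volume measure and $\Delta_\delta=\frac1{\sqrt{\tilde g}}\sum_{j,k}\partial_j\big(\sqrt{\tilde g}\,\tilde g^{jk}\partial_k\big)$ its Laplace operator. Put $$\|f\|_{L^2_{k,\delta}}=\Big(\int_{U_\delta}\sum_{|\nu|\le k}|\partial^\nu f|^2\,d\mathrm{vol}_\delta\Big)^{1/2},\qquad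 L^2_\delta=L^2_{0,\delta},$$ where $\partial^\nu$ are (weak) partial derivatives in the coordinates $(x,y,\kappa)$. Let $L^2_{k,\delta}$ be the space of functions whose weak derivatives of order at most $k$ are square integrable, and let $\mathring L^2_{k,\delta}$ be the closure in it of $C_c^\infty(U_\delta)$. Then there are constants $C$, depending only on $n$ and not on $\delta$, $f$ or $\psi$, such that: 1. if $f\in \mathring L^2_{2,\delta}$, $\psi\in L^2_\delta$ and $\Delta_\delta f=\psi$ in $U_\delta$ (in the sense of distributions), then $\|f\|_{L^2_{2,\delta}}\le C\|\psi\|_{L^2_\delta}$; 2. if $f\in \mathring L^2_{4,\delta}$, $\psi\in L^2_{2,\delta}$ and $\Delta_\delta f=\psi$ in $U_\delta$, then $\|f\|_{L^2_{4,\delta}}\le C\|\psi\|_{L^2_{2,\delta}}$. -/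

import Mathlib

open MeasureTheory
open scoped ENNReal NNReal ContDiff

noncomputable section

namespace NeckEstimate

/-- The coordinate space `ℝⁿ`, `n = m + 2`, with coordinates `(x, y, κ₁, …, κ_m)`:
`p 0 = x`, `p 1 = y`, and the remaining entries are coordinates on the codimension-two factor `K`. -/
abbrev Chart (m : ℕ) : Type := EuclideanSpace ℝ (Fin (m + 2))

/-- The neck region `{δ² < x² + y² < δ} × ℝ^m`. -/
def neck (m : ℕ) (δ : ℝ) : Set (Chart m) :=
  {p | δ ^ 2 < p 0 ^ 2 + p 1 ^ 2 ∧ p 0 ^ 2 + p 1 ^ 2 < δ}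

/-- The classical partial derivative `∂φ/∂xⁱ`. -/
def pderiv {m : ℕ} (i : Fin (m + 2)) (φ : Chart m → ℝ) : Chart m → ℝ :=
  fun p => fderiv ℝ φ p (EuclideanSpace.single i 1)

/-- The classical partial derivative `∂^ν φ` for a multi-index `ν`. -/
def multiDeriv {m : ℕ} (ν : Fin (m + 2) → ℕ) (φ : Chart m → ℝ) : Chart m → ℝ :=
  (List.finRange (m + 2)).foldr (fun i g => (pderiv i)^[ν i] g) φ

/-- The multi-indices `ν` with `|ν| ≤ k`. -/
def multiIndices (m k : ℕ) : Finset (Fin (m + 2) → ℕ) :=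
  (Fintype.piFinset fun _ => Finset.range (k + 1)).filter fun ν => ∑ i, ν i ≤ k

/-! ### The metric of the neck -/

/-- With `z₁ = x + i y` and `z₂ = u + i v`, the neck `z₁ z̄₂ = δ² / 2` is the graph of
`u = δ² x / (2 (x² + y²))`, `v = δ² y / (2 (x² + y²))`. This is the function `u`. -/
def graphU (m : ℕ) (δ : ℝ) : Chart m → ℝ :=
  fun p => δ ^ 2 * p 0 / (2 * (p 0 ^ 2 + p 1 ^ 2))

/-- The function `v = δ² y / (2 (x² + y²))`. -/
def graphV (m : ℕ) (δ : ℝ) : Chart m → ℝ :=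
  fun p => δ ^ 2 * p 1 / (2 * (p 0 ^ 2 + p 1 ^ 2))

/-- The matrix, in the coordinates `(x, y, κ)`, of the metric
`dx² + dy² + du² + dv² + dκ₁² + … + dκ_m²` restricted to the neck. -/
def metric (m : ℕ) (δ : ℝ) (p : Chart m) : Matrix (Fin (m + 2)) (Fin (m + 2)) ℝ :=
  Matrix.of fun i j => (if i = j then 1 else 0)
    + pderiv i (graphU m δ) p * pderiv j (graphU m δ) p
    + pderiv i (graphV m δ) p * pderiv j (graphV m δ) p

/-- The volume density `√det g`. -/
def volDensity (m : ℕ) (δ : ℝ) (p : Chart m) : ℝ := Real.sqrt (metric m δ p).det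

/-- The Riemannian volume measure `dvol_δ` of the neck. -/
def dvol (m : ℕ) (δ : ℝ) : Measure (Chart m) :=
  (volume.restrict (neck m δ)).withDensity fun p => ENNReal.ofReal (volDensity m δ p)

/-! ### Sobolev spaces on the neck -/

/-- Test functions: smooth functions with compact support in the neck. -/
def IsTest (m : ℕ) (δ : ℝ) (φ : Chart m → ℝ) : Prop :=
  ContDiff ℝ ∞ φ ∧ HasCompactSupport φ ∧ tsupport φ ⊆ neck m δ

/-- `g` is the weak derivative `∂^ν f` on the neck. -/
def HasWeakDeriv (m : ℕ) (δ : ℝ) (ν : Fin (m + 2) → ℕ) (f g : Chart m → ℝ) : Prop :=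
  LocallyIntegrableOn f (neck m δ) ∧ LocallyIntegrableOn g (neck m δ) ∧
    ∀ φ, IsTest m δ φ →
      ∫ p in neck m δ, f p * multiDeriv ν φ p
        = (-1) ^ (∑ i, ν i) * ∫ p in neck m δ, g p * φ p

open Classical in
/-- The weak derivative `∂^ν f` on the neck (unique up to null sets; `0` if there is none). -/
def weakDeriv (m : ℕ) (δ : ℝ) (ν : Fin (m + 2) → ℕ) (f : Chart m → ℝ) : Chart m → ℝ :=
  if h : ∃ g, HasWeakDeriv m δ ν f g then h.choose else 0

/-- The norm `‖f‖_{L²_{k,δ}} = (∑_{|ν| ≤ k} ∫ |∂^ν f|² dvol_δ)^{1/2}`, with values in `[0, ∞]`. -/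
def sobolevNorm (m : ℕ) (δ : ℝ) (k : ℕ) (f : Chart m → ℝ) : ℝ≥0∞ :=
  (∑ ν ∈ multiIndices m k, ∫⁻ p, ‖weakDeriv m δ ν f p‖ₑ ^ 2 ∂(dvol m δ)) ^ (1 / 2 : ℝ)

/-- `f ∈ L²_{k,δ}`: all weak derivatives of order at most `k` exist and are square integrable. -/
def MemSobolev (m : ℕ) (δ : ℝ) (k : ℕ) (f : Chart m → ℝ) : Prop :=
  ∀ ν ∈ multiIndices m k, ∃ g, HasWeakDeriv m δ ν f g ∧ MemLp g 2 (dvol m δ)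

/-- `f` lies in the closure in `L²_{k,δ}` of the smooth functions with compact support in the
neck. -/
def MemSobolevZero (m : ℕ) (δ : ℝ) (k : ℕ) (f : Chart m → ℝ) : Prop :=
  MemSobolev m δ k f ∧
    ∀ ε : ℝ≥0∞, 0 < ε → ∃ φ, IsTest m δ φ ∧ sobolevNorm m δ k (f - φ) < ε

/-! ### The Laplace operator -/

/-- The equation `Δ_δ f = ψ` on the neck in the sense of distributions, where `Δ_δ` is the
Laplace–Beltrami operator `(1/√g) ∑_{j,k} ∂_j (√g g^{jk} ∂_k f)`. -/
def LaplaceEq (m : ℕ) (δ : ℝ) (f ψ : Chart m → ℝ) : Prop :=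
  ∀ φ, IsTest m δ φ →
    ∫ p in neck m δ, ∑ j, ∑ k, volDensity m δ p * (metric m δ p)⁻¹ j k
        * weakDeriv m δ (Pi.single k 1) f p * pderiv j φ p
      = - ∫ p in neck m δ, volDensity m δ p * ψ p * φ p

end NeckEstimate

end

noncomputable section

namespace NeckEstimate

variable {m : ℕ} {δ : ℝ}

/-! ### Calculus of coordinate derivatives -/

/-! Both estimates are proved for test functions with explicit constants free of `δ`, then carried
to the closure. In the given coordinates the metric is diagonal, and `Δ_δ = a Δ_xy + Δ_K`, where `a
= invConf` is the inverse conformal factor. Since `r > δ` on the neck, `4/5 ≤ a ≤ 1`.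

Second order: integration by parts has no boundary terms, so `‖Δu‖²` equals the sum of all
`‖∂ᵢ∂ⱼu‖²`, and `∫ Δ_xy u · Δ_K u ≥ 0`. Because of this sign, `a` can be replaced by `1` at the cost
of a constant (`sqNorm_lap_le`). Lower derivatives follow from Poincaré's inequality in the strip
`|x| < 1`.

Fourth order: the equation cannot simply be differentiated in `x, y`, because the derivatives of the
conformal factor reach size `1/δ` near the inner boundary. But `Δ_K` commutes with `Δ_δ`, so the
second-order estimate controls `Δ_K u`. For the rest, `Δ_xy u = conf · w` with `w = Δ_δ u - Δ_K u`.
Differentiating `conf` produces terms of size `δ⁴ r⁻⁵ |∇w|` and `δ⁴ r⁻⁶ |w|`. Hardy's inequality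
trades each surplus `1/r` for a derivative, and the remaining weight `δ⁴ r⁻⁴` is at most `1`
(`sqNorm_lapXY_conf_mul_le`). This bounds `Δ²u` by `Δ(Δ_δ u)` in `L²` (`sqNorm_lap_lap_le`).

Density: if test functions `φₙ` tend to `f`, then `Δ_δ φₙ` tends to `ψ` as distributions and is
Cauchy in the Sobolev norm, so it tends to `ψ` in that norm and the uniform estimate passes to the
limit (`sobolevNorm_le_of_test`). -/

lemma contDiff_pderiv {u : Chart m → ℝ} (hu : ContDiff ℝ ∞ u) (i : Fin (m + 2)) :
    ContDiff ℝ ∞ (pderiv i u) :=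
  (hu.fderiv_right (m := ∞) le_rfl).clm_apply contDiff_const

lemma differentiableAt_of_smooth {u : Chart m → ℝ} (hu : ContDiff ℝ ∞ u) (p : Chart m) :
    DifferentiableAt ℝ u p :=
  (hu.differentiable (by simp)) p

lemma pderiv_congr {u v : Chart m → ℝ} {p : Chart m} (h : u =ᶠ[nhds p] v) (i : Fin (m + 2)) :
    pderiv i u p = pderiv i v p := by
  simp only [pderiv, h.fderiv_eq]

lemma pderiv_mul_apply {u v : Chart m → ℝ} {p : Chart m} (hu : DifferentiableAt ℝ u p)
    (hv : DifferentiableAt ℝ v p) (i : Fin (m + 2)) :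
    pderiv i (fun q => u q * v q) p = pderiv i u p * v p + u p * pderiv i v p := by
  simp only [pderiv, fderiv_fun_mul hu hv]
  simp [mul_comm]
  ring

lemma pderiv_add_apply {u v : Chart m → ℝ} {p : Chart m} (hu : DifferentiableAt ℝ u p)
    (hv : DifferentiableAt ℝ v p) (i : Fin (m + 2)) :
    pderiv i (fun q => u q + v q) p = pderiv i u p + pderiv i v p := by
  simp only [pderiv, fderiv_fun_add hu hv]
  simp

lemma pderiv_sum_apply {ι : Type*} {u : ι → Chart m → ℝ} (s : Finset ι) {p : Chart m}
    (hu : ∀ j ∈ s, DifferentiableAt ℝ (u j) p) (i : Fin (m + 2)) :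
    pderiv i (fun q => ∑ j ∈ s, u j q) p = ∑ j ∈ s, pderiv i (u j) p := by
  simp only [pderiv, fderiv_fun_sum hu]
  simp

lemma pderiv_sub_apply {u v : Chart m → ℝ} {p : Chart m} (hu : DifferentiableAt ℝ u p)
    (hv : DifferentiableAt ℝ v p) (i : Fin (m + 2)) :
    pderiv i (fun q => u q - v q) p = pderiv i u p - pderiv i v p := by
  simp only [pderiv, fderiv_fun_sub hu hv]
  simp

lemma pderiv_const_mul_apply {u : Chart m → ℝ} {p : Chart m} (hu : DifferentiableAt ℝ u p)
    (c : ℝ) (i : Fin (m + 2)) :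
    pderiv i (fun q => c * u q) p = c * pderiv i u p := by
  simp only [pderiv, fderiv_const_mul hu]
  simp

lemma pderiv_comp_apply {u : Chart m → ℝ} {p : Chart m} {g : ℝ → ℝ} {g' : ℝ}
    (hg : HasDerivAt g g' (u p)) (hu : DifferentiableAt ℝ u p) (i : Fin (m + 2)) :
    pderiv i (fun q => g (u q)) p = g' * pderiv i u p := by
  have := (hg.comp_hasFDerivAt p hu.hasFDerivAt).fderiv
  simp only [pderiv]
  rw [show (fun q => g (u q)) = g ∘ u from rfl, this]
  simp

lemma pderiv_comm {u : Chart m → ℝ} (hu : ContDiff ℝ ∞ u) (i j : Fin (m + 2)) :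
    pderiv i (pderiv j u) = pderiv j (pderiv i u) := by
  ext p
  have hd : DifferentiableAt ℝ (fderiv ℝ u) p :=
    ((hu.fderiv_right (m := ∞) le_rfl).differentiable (by simp)) p
  have key : ∀ k l : Fin (m + 2), pderiv k (pderiv l u) p
      = fderiv ℝ (fderiv ℝ u) p (EuclideanSpace.single k 1) (EuclideanSpace.single l 1) := by
    intro k l
    change fderiv ℝ (fun q => fderiv ℝ u q (EuclideanSpace.single l 1)) p
      (EuclideanSpace.single k 1) = _
    rw [fderiv_clm_apply hd (differentiableAt_const _)]
    simp
  rw [key, key]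
  have hs : IsSymmSndFDerivAt ℝ u p :=
    hu.contDiffAt.isSymmSndFDerivAt (by
      rw [minSmoothness_of_isRCLikeNormedField]
      exact WithTop.coe_le_coe.2 (le_top : (2 : ℕ∞) ≤ ⊤))
  exact hs _ _

lemma pderiv_coord (i j : Fin (m + 2)) (p : Chart m) :
    pderiv i (fun q => q j) p = if i = j then 1 else 0 := by
  have : (fun q : Chart m => q j) = (EuclideanSpace.proj j : Chart m →L[ℝ] ℝ) := rfl
  rw [pderiv, this, ContinuousLinearMap.fderiv]
  simp [eq_comm]

lemma contDiff_coord (j : Fin (m + 2)) : ContDiff ℝ ∞ (fun q : Chart m => q j) :=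
  (EuclideanSpace.proj j : Chart m →L[ℝ] ℝ).contDiff

/-! ### The neck and its test functions -/

lemma isOpen_neck (m : ℕ) (δ : ℝ) : IsOpen (neck m δ) := by
  have h : Continuous fun p : Chart m => p 0 ^ 2 + p 1 ^ 2 :=
    (((contDiff_coord 0).continuous).pow 2).add (((contDiff_coord 1).continuous).pow 2)
  exact (isOpen_lt continuous_const h).inter (isOpen_lt h continuous_const)

namespace IsTest

variable {u v : Chart m → ℝ}

lemma diff (hu : IsTest m δ u) (p : Chart m) : DifferentiableAt ℝ u p :=
  differentiableAt_of_smooth hu.1 p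

lemma continuous (hu : IsTest m δ u) : Continuous u := hu.1.continuous

lemma integrable (hu : IsTest m δ u) : Integrable u :=
  hu.continuous.integrable_of_hasCompactSupport hu.2.1

lemma eventually_zero (hu : IsTest m δ u) {p : Chart m} (hp : p ∉ neck m δ) :
    u =ᶠ[nhds p] 0 :=
  notMem_tsupport_iff_eventuallyEq.1 fun h => hp (hu.2.2 h)

lemma eq_zero (hu : IsTest m δ u) {p : Chart m} (hp : p ∉ neck m δ) : u p = 0 :=
  (hu.eventually_zero hp).self_of_nhds

lemma of_tsupport (hu : IsTest m δ u) (hv : ContDiff ℝ ∞ v)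
    (h : tsupport v ⊆ tsupport u) : IsTest m δ v :=
  ⟨hv, hu.2.1.of_isClosed_subset (isClosed_tsupport _) h, h.trans hu.2.2⟩

lemma pderiv (hu : IsTest m δ u) (i : Fin (m + 2)) : IsTest m δ (pderiv i u) :=
  hu.of_tsupport (contDiff_pderiv hu.1 i) (tsupport_fderiv_apply_subset ℝ _)

/-- The factor need only be smooth on the neck, which admits weights singular on the axis `x = y =
0`, such as `r⁻²ᵏ` and `conf`. -/
lemma mul_left_of_contDiffAt (hu : IsTest m δ u) {a : Chart m → ℝ}
    (ha : ∀ p ∈ neck m δ, ContDiffAt ℝ ∞ a p) : IsTest m δ (fun p => a p * u p) := by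
  refine hu.of_tsupport (contDiff_iff_contDiffAt.2 fun p => ?_)
    (tsupport_mul_subset_right (f := a) (g := u))
  by_cases hp : p ∈ neck m δ
  · exact (ha p hp).mul hu.1.contDiffAt
  · refine (contDiffAt_const (c := (0 : ℝ))).congr_of_eventuallyEq ?_
    filter_upwards [hu.eventually_zero hp] with q hq
    simp [hq]

lemma smooth_mul (hu : IsTest m δ u) {a : Chart m → ℝ} (ha : ContDiff ℝ ∞ a) :
    IsTest m δ (fun p => a p * u p) :=
  hu.mul_left_of_contDiffAt fun _ _ => ha.contDiffAt

lemma mul (hu : IsTest m δ u) (hv : IsTest m δ v) : IsTest m δ (fun p => u p * v p) :=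
  hv.smooth_mul hu.1

lemma sq (hu : IsTest m δ u) : IsTest m δ (fun p => u p ^ 2) := by
  simpa only [pow_two] using hu.mul hu

lemma const_mul (hu : IsTest m δ u) (c : ℝ) : IsTest m δ (fun p => c * u p) :=
  hu.smooth_mul contDiff_const

lemma zero : IsTest m δ (fun _ => 0) := by
  refine ⟨contDiff_const, HasCompactSupport.zero, ?_⟩
  have : tsupport (fun _ : Chart m => (0 : ℝ)) = ∅ := by
    rw [tsupport_eq_empty_iff]; rfl
  simp [this]

lemma add (hu : IsTest m δ u) (hv : IsTest m δ v) : IsTest m δ (fun p => u p + v p) :=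
  ⟨hu.1.add hv.1, hu.2.1.add hv.2.1,
    (tsupport_add u v).trans (Set.union_subset hu.2.2 hv.2.2)⟩

lemma sub (hu : IsTest m δ u) (hv : IsTest m δ v) : IsTest m δ (fun p => u p - v p) := by
  simpa [sub_eq_add_neg] using hu.add (hv.const_mul (-1))

lemma sum {ι : Type*} (s : Finset ι) {w : ι → Chart m → ℝ} (h : ∀ j ∈ s, IsTest m δ (w j)) :
    IsTest m δ (fun p => ∑ j ∈ s, w j p) := by
  classical
  induction s using Finset.induction_on with
  | empty => simpa using zero
  | insert a s ha ih =>
    simp only [Finset.sum_insert ha]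
    exact (h a (by simp)).add (ih fun j hj => h j (by simp [hj]))

lemma integral_pderiv (hu : IsTest m δ u) (i : Fin (m + 2)) :
    ∫ p, NeckEstimate.pderiv i u p = 0 := by
  have h := integral_mul_fderiv_eq_neg_fderiv_mul_of_integrable (μ := (volume : Measure (Chart m)))
    (f := fun _ => (1 : ℝ)) (g := u) (v := EuclideanSpace.single i 1)
    (by simp) (by simpa [NeckEstimate.pderiv] using! (hu.pderiv i).integrable) (by simpa using hu.integrable)
    (fun _ _ => differentiableAt_const _) (fun x _ => hu.diff x)
  simpa [NeckEstimate.pderiv] using h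

lemma integral_mul_pderiv (hu : IsTest m δ u) (hv : ContDiff ℝ ∞ v) (i : Fin (m + 2)) :
    ∫ p, u p * NeckEstimate.pderiv i v p = - ∫ p, NeckEstimate.pderiv i u p * v p := by
  have h := (hu.smooth_mul hv).integral_pderiv i
  have e : NeckEstimate.pderiv i (fun p => v p * u p)
      = fun p => u p * NeckEstimate.pderiv i v p + NeckEstimate.pderiv i u p * v p := by
    ext p
    rw [pderiv_mul_apply (differentiableAt_of_smooth hv p) (hu.diff p)]
    ring
  rw [e, integral_add] at h
  · linarith
  · simpa only [mul_comm] using (hu.smooth_mul (contDiff_pderiv hv i)).integrable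
  · simpa only [mul_comm] using ((hu.pderiv i).smooth_mul hv).integrable

lemma setIntegral_eq (hu : IsTest m δ u) : ∫ p in neck m δ, u p = ∫ p, u p :=
  setIntegral_eq_integral_of_forall_compl_eq_zero fun _ hp => hu.eq_zero hp

lemma memLp (hu : IsTest m δ u) (μ : Measure (Chart m)) [IsFiniteMeasureOnCompacts μ] :
    MemLp u 2 μ :=
  hu.continuous.memLp_of_hasCompactSupport hu.2.1

end IsTest

/-! ### The Laplace operators and the second-order estimate for test functions -/

/-- The squared `L²` norm. -/
def sqNorm (u : Chart m → ℝ) : ℝ := ∫ p, u p ^ 2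

/-- The Euclidean Laplacian in the variables `(x, y)`. -/
def lapXY (u : Chart m → ℝ) : Chart m → ℝ :=
  fun p => pderiv 0 (pderiv 0 u) p + pderiv 1 (pderiv 1 u) p

/-- The Euclidean Laplacian in the variables `κ`. -/
def lapK (u : Chart m → ℝ) : Chart m → ℝ :=
  fun p => ∑ j : Fin m, pderiv j.succ.succ (pderiv j.succ.succ u) p

/-- The Euclidean Laplacian. -/
def lap (u : Chart m → ℝ) : Chart m → ℝ :=
  fun p => ∑ j, pderiv j (pderiv j u) p

/-- The inverse `4r⁴ / (4r⁴ + δ⁴)` of the conformal factor `1 + δ⁴ / (4r⁴)`. -/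
def invConf (m : ℕ) (δ : ℝ) : Chart m → ℝ :=
  fun p => 4 * (p 0 ^ 2 + p 1 ^ 2) ^ 2 / (4 * (p 0 ^ 2 + p 1 ^ 2) ^ 2 + δ ^ 4)

/-- The Laplace–Beltrami operator of the neck. -/
def lapNeck (δ : ℝ) (u : Chart m → ℝ) : Chart m → ℝ :=
  fun p => invConf m δ p * lapXY u p + lapK u p

lemma lap_apply (u : Chart m → ℝ) (p : Chart m) : lap u p = lapXY u p + lapK u p := by
  simp only [lap, lapXY, lapK, Fin.sum_univ_succ, add_assoc]
  rfl

/-- The term `δ⁴` keeps the denominator positive even on the axis, so smoothness holds on the whole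
space. -/
lemma contDiff_invConf (hδ : 0 < δ) : ContDiff ℝ ∞ (invConf m δ) := by
  have h0 := contDiff_coord (m := m) 0
  have h1 := contDiff_coord (m := m) 1
  have hs := (h0.pow 2).add (h1.pow 2)
  refine (contDiff_const.mul (hs.pow 2)).div ((contDiff_const.mul (hs.pow 2)).add contDiff_const) ?_
  intro p
  have : 0 < δ ^ 4 := by positivity
  positivity

/-- The neck gives `r⁴ > δ⁴`; the value `4/5` is the one at `r = δ`. -/
lemma invConf_bounds (hδ : 0 < δ) {p : Chart m} (hp : p ∈ neck m δ) :
    4 / 5 ≤ invConf m δ p ∧ invConf m δ p ≤ 1 := by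
  have hs : δ ^ 4 ≤ (p 0 ^ 2 + p 1 ^ 2) ^ 2 := by
    have := hp.1
    nlinarith [sq_nonneg δ]
  have hd : 0 < δ ^ 4 := by positivity
  constructor
  · rw [invConf, div_le_div_iff₀ (by norm_num) (by positivity)]; linarith
  · rw [invConf, div_le_one (by positivity)]; linarith

lemma sqNorm_nonneg (u : Chart m → ℝ) : 0 ≤ sqNorm u := integral_nonneg fun _ => sq_nonneg _

namespace IsTest

variable {u v : Chart m → ℝ}

lemma lapXY (hu : IsTest m δ u) : IsTest m δ (lapXY u) :=
  ((hu.pderiv 0).pderiv 0).add ((hu.pderiv 1).pderiv 1)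

lemma lapK (hu : IsTest m δ u) : IsTest m δ (lapK u) :=
  sum _ fun j _ => (hu.pderiv j.succ.succ).pderiv j.succ.succ

lemma lap (hu : IsTest m δ u) : IsTest m δ (lap u) :=
  sum _ fun j _ => (hu.pderiv j).pderiv j

lemma lapNeck (hδ : 0 < δ) (hu : IsTest m δ u) : IsTest m δ (lapNeck δ u) :=
  (hu.lapXY.smooth_mul (contDiff_invConf hδ)).add hu.lapK

lemma sqNorm_le_of_sq_le (hu : IsTest m δ u) {g : Chart m → ℝ} (hg : Integrable g)
    (h : ∀ p, u p ^ 2 ≤ g p) : sqNorm u ≤ ∫ p, g p :=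
  integral_mono hu.sq.integrable hg h

lemma sqNorm_const_mul (c : ℝ) : sqNorm (fun p => c * u p) = c ^ 2 * sqNorm u := by
  simp only [sqNorm, mul_pow, integral_const_mul]

lemma sqNorm_add_le (hu : IsTest m δ u) (hv : IsTest m δ v) :
    sqNorm (fun p => u p + v p) ≤ 2 * sqNorm u + 2 * sqNorm v := by
  simp only [sqNorm, ← integral_const_mul]
  rw [← integral_add (hu.sq.integrable.const_mul _) (hv.sq.integrable.const_mul _)]
  exact integral_mono (hu.add hv).sq.integrable
    ((hu.sq.integrable.const_mul _).add (hv.sq.integrable.const_mul _))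
    fun p => by dsimp only; nlinarith [sq_nonneg (u p - v p)]

lemma sqNorm_sub_le (hu : IsTest m δ u) (hv : IsTest m δ v) :
    sqNorm (fun p => u p - v p) ≤ 2 * sqNorm u + 2 * sqNorm v := by
  have := hu.sqNorm_add_le (hv.const_mul (-1))
  rw [sqNorm_const_mul] at this
  simpa [sub_eq_add_neg] using this

lemma sqNorm_sum_le {ι : Type*} (s : Finset ι) {w : ι → Chart m → ℝ}
    (h : ∀ j ∈ s, IsTest m δ (w j)) :
    sqNorm (fun p => ∑ j ∈ s, w j p) ≤ s.card * ∑ j ∈ s, sqNorm (w j) := by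
  simp only [sqNorm]
  rw [← integral_finsetSum _ fun j hj => (h j hj).sq.integrable, ← integral_const_mul]
  exact integral_mono (sum s h).sq.integrable
    ((integrable_finsetSum _ fun j hj => (h j hj).sq.integrable).const_mul _)
    fun p => sq_sum_le_card_mul_sum_sq

/-- Two integrations by parts move one `∂ⱼ` to the left factor and one `∂ᵢ` to the right factor; the
two signs cancel. -/
lemma integral_pderiv_sq_mul (hu : IsTest m δ u) (i j : Fin (m + 2)) :
    ∫ p, NeckEstimate.pderiv i (NeckEstimate.pderiv i u) p *
      NeckEstimate.pderiv j (NeckEstimate.pderiv j u) p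
      = sqNorm (NeckEstimate.pderiv i (NeckEstimate.pderiv j u)) := by
  have hj := hu.pderiv j
  rw [((hu.pderiv i).pderiv i).integral_mul_pderiv hj.1 j,
    pderiv_comm (hu.pderiv i).1 j i, pderiv_comm hu.1 j i]
  have h2 := hj.integral_mul_pderiv (hj.pderiv i).1 i
  simp only [mul_comm (NeckEstimate.pderiv j u _)] at h2
  rw [h2, neg_neg, sqNorm]
  simp only [pow_two]

lemma sqNorm_lap (hu : IsTest m δ u) :
    sqNorm (NeckEstimate.lap u)
      = ∑ i, ∑ j, sqNorm (NeckEstimate.pderiv i (NeckEstimate.pderiv j u)) := by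
  have hI : ∀ i j : Fin (m + 2), Integrable fun p =>
      NeckEstimate.pderiv i (NeckEstimate.pderiv i u) p *
      NeckEstimate.pderiv j (NeckEstimate.pderiv j u) p :=
    fun i j => (((hu.pderiv i).pderiv i).mul ((hu.pderiv j).pderiv j)).integrable
  simp only [← hu.integral_pderiv_sq_mul]
  simp only [sqNorm, NeckEstimate.lap, pow_two, Finset.sum_mul_sum]
  rw [integral_finsetSum _ fun i _ => integrable_finsetSum _ fun j _ => hI i j]
  exact Finset.sum_congr rfl fun i _ => integral_finsetSum _ fun j _ => hI i j

lemma sqNorm_pderiv_pderiv_le_lap (hu : IsTest m δ u) (i j : Fin (m + 2)) :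
    sqNorm (NeckEstimate.pderiv i (NeckEstimate.pderiv j u)) ≤ sqNorm (NeckEstimate.lap u) := by
  rw [hu.sqNorm_lap]
  refine le_trans ?_ (Finset.single_le_sum (fun i _ => Finset.sum_nonneg fun j _ =>
    sqNorm_nonneg _) (Finset.mem_univ i))
  exact Finset.single_le_sum (f := fun j => sqNorm (NeckEstimate.pderiv i (NeckEstimate.pderiv j u)))
    (fun j _ => sqNorm_nonneg _) (Finset.mem_univ j)

/-- Each product `∂ᵢ²u ∂ⱼ²u` integrates to the squared norm of a mixed derivative. -/
lemma integral_lapXY_mul_lapK_nonneg (hu : IsTest m δ u) :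
    0 ≤ ∫ p, NeckEstimate.lapXY u p * NeckEstimate.lapK u p := by
  have hI : ∀ i j : Fin (m + 2), Integrable fun p =>
      NeckEstimate.pderiv i (NeckEstimate.pderiv i u) p *
      NeckEstimate.pderiv j (NeckEstimate.pderiv j u) p :=
    fun i j => (((hu.pderiv i).pderiv i).mul ((hu.pderiv j).pderiv j)).integrable
  simp only [NeckEstimate.lapXY, NeckEstimate.lapK, Finset.mul_sum, add_mul,
    Finset.sum_add_distrib]
  rw [integral_add (integrable_finsetSum _ fun j _ => hI _ _)
    (integrable_finsetSum _ fun j _ => hI _ _),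
    integral_finsetSum _ fun j _ => hI _ _, integral_finsetSum _ fun j _ => hI _ _]
  simp only [hu.integral_pderiv_sq_mul]
  exact add_nonneg (Finset.sum_nonneg fun _ _ => sqNorm_nonneg _)
    (Finset.sum_nonneg fun _ _ => sqNorm_nonneg _)

lemma sqNorm_lap_le (hδ : 0 < δ) (hu : IsTest m δ u) :
    sqNorm (NeckEstimate.lap u) ≤ 2 * sqNorm (NeckEstimate.lapNeck δ u) := by
  have hAB := (hu.lapXY.mul hu.lapK).integrable
  -- With `A = Δ_xy u` and `B = Δ_K u`, the coefficient `2/5` of `AB` makes the `A²` and `AB` terms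
  -- agree on both sides at the extreme value `a = 4/5`. The `AB` term on the left is later dropped,
  -- its integral being nonnegative.
  have key : ∫ p, (4 / 5 * NeckEstimate.lap u p ^ 2
      + 2 / 5 * (NeckEstimate.lapXY u p * NeckEstimate.lapK u p))
      ≤ ∫ p, 5 / 4 * NeckEstimate.lapNeck δ u p ^ 2 := by
    refine integral_mono ((hu.lap.sq.integrable.const_mul _).add (hAB.const_mul _))
      ((hu.lapNeck hδ).sq.integrable.const_mul _) fun p => ?_
    dsimp only
    by_cases hp : p ∈ neck m δ
    · obtain ⟨h1, h2⟩ := invConf_bounds hδ hp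
      rw [lap_apply]
      simp only [NeckEstimate.lapNeck]
      generalize NeckEstimate.lapXY u p = A
      generalize NeckEstimate.lapK u p = B
      obtain ⟨t, ht⟩ : ∃ t, invConf m δ p = 4 / 5 + t := ⟨invConf m δ p - 4 / 5, by ring⟩
      rw [ht] at h1 h2 ⊢
      have t0 : 0 ≤ t := by linarith
      have t1 : 0 ≤ 1 / 5 - t := by linarith
      nlinarith [mul_nonneg t0 (sq_nonneg (A + 5 / 8 * B)), mul_nonneg t1 (sq_nonneg B),
        mul_nonneg t0 (sq_nonneg B), sq_nonneg (t * A)]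
    · rw [hu.lap.eq_zero hp, hu.lapXY.eq_zero hp, (hu.lapNeck hδ).eq_zero hp]
      simp
  rw [integral_add (hu.lap.sq.integrable.const_mul _) (hAB.const_mul _), integral_const_mul,
    integral_const_mul, integral_const_mul] at key
  have h1 := hu.integral_lapXY_mul_lapK_nonneg
  have h2 := sqNorm_nonneg (NeckEstimate.lapNeck δ u)
  simp only [sqNorm] at h2 ⊢
  linarith

/-- Poincaré's inequality in the strip `|x| < 1`. -/
lemma sqNorm_le_pderiv (hδ : δ < 1) (hu : IsTest m δ u) :
    sqNorm u ≤ 4 * sqNorm (NeckEstimate.pderiv 0 u) := by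
  -- Integration by parts against `x u` gives `‖u‖² = -2 ∫ x u ∂ₓu`, to be absorbed using `x² ≤ 1`.
  have hxu := hu.smooth_mul (contDiff_coord 0)
  have h0 := hxu.integral_mul_pderiv hu.1 0
  have e : NeckEstimate.pderiv 0 (fun p : Chart m => p 0 * u p)
      = fun p => u p + p 0 * NeckEstimate.pderiv 0 u p := by
    ext p
    rw [pderiv_mul_apply (differentiableAt_of_smooth (contDiff_coord 0) p) (hu.diff p),
      pderiv_coord]
    simp
  have hI := (hxu.mul (hu.pderiv 0)).integrable
  have h1 : ∫ p, NeckEstimate.pderiv 0 (fun p : Chart m => p 0 * u p) p * u p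
      = sqNorm u + ∫ p : Chart m, p 0 * u p * NeckEstimate.pderiv 0 u p := by
    rw [e, sqNorm, ← integral_add hu.sq.integrable hI]
    congr 1; ext p; ring
  have h2 : ∫ p : Chart m, -(2 * (p 0 * u p * NeckEstimate.pderiv 0 u p))
      ≤ ∫ p, (1 / 2 * u p ^ 2 + 2 * NeckEstimate.pderiv 0 u p ^ 2) := by
    refine integral_mono (hI.const_mul _).neg
      ((hu.sq.integrable.const_mul _).add ((hu.pderiv 0).sq.integrable.const_mul _)) fun p => ?_
    dsimp only
    by_cases hp : p ∈ neck m δ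
    · have hx : p 0 ^ 2 ≤ 1 := by nlinarith [hp.2, sq_nonneg (p 1)]
      nlinarith [sq_nonneg (u p + 2 * (p 0 * NeckEstimate.pderiv 0 u p)),
        mul_nonneg (sub_nonneg.2 hx) (sq_nonneg (NeckEstimate.pderiv 0 u p))]
    · rw [hu.eq_zero hp, (hu.pderiv 0).eq_zero hp]; simp
  rw [integral_neg, integral_const_mul, integral_add (hu.sq.integrable.const_mul _)
    ((hu.pderiv 0).sq.integrable.const_mul _), integral_const_mul, integral_const_mul] at h2
  rw [h1] at h0
  simp only [sqNorm] at h0 ⊢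
  linarith

end IsTest

/-! ### Functions of `(x, y)` -/

/-- `a` is a function of `(x, y)` alone. -/
def DependsOnXY (a : Chart m → ℝ) : Prop :=
  ∀ p q : Chart m, p 0 = q 0 → p 1 = q 1 → a p = a q

lemma dependsOnXY_invConf : DependsOnXY (invConf m δ) := by
  intro p q h0 h1
  simp only [invConf, h0, h1]

/-- Translation by `q - p` leaves `a` invariant when `p` and `q` share their `x, y` coordinates, so
the derivatives there agree, without any smoothness. -/
lemma DependsOnXY.pderiv {a : Chart m → ℝ} (ha : DependsOnXY a) (i : Fin (m + 2)) :
    DependsOnXY (pderiv i a) := by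
  intro p q h0 h1
  have h : (fun z => a (z + (q - p))) = a := by
    ext z
    exact ha _ _ (by simp [h0]) (by simp [h1])
  have := fderiv_comp_add_right (𝕜 := ℝ) (f := a) (x := p) (q - p)
  rw [h, add_sub_cancel] at this
  simp only [NeckEstimate.pderiv, this]

lemma DependsOnXY.pderiv_eq_zero {a : Chart m → ℝ} (ha : DependsOnXY a) (j : Fin m) (p : Chart m)
    (hd : DifferentiableAt ℝ a p) : NeckEstimate.pderiv j.succ.succ a p = 0 := by
  rw [NeckEstimate.pderiv, ← hd.lineDeriv_eq_fderiv, lineDeriv]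
  have : (fun t : ℝ => a (p + t • EuclideanSpace.single j.succ.succ 1)) = fun _ => a p := by
    ext t
    refine ha _ _ ?_ ?_
    · simp [(Fin.succ_ne_zero j.succ).symm]
    · have : (1 : Fin (m + 2)) ≠ j.succ.succ := by
        intro h
        exact absurd (congrArg Fin.val h) (by simp)
      simp [this]
  rw [this, deriv_const]

/-- The neck is unbounded in `κ`, but every value is attained at a point with `κ = 0`, which lies in
the compact unit ball because `r² < δ < 1`. -/
lemma DependsOnXY.exists_bound {a : Chart m → ℝ} (ha : DependsOnXY a) (hc : Continuous a)
    (hδ1 : δ < 1) : ∃ C : ℝ, ∀ p ∈ neck m δ, |a p| ≤ C := by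
  obtain ⟨C, hC⟩ := (isCompact_closedBall (0 : Chart m) 1).exists_bound_of_continuousOn
    hc.continuousOn
  refine ⟨C, fun p hp => ?_⟩
  let q : Chart m := EuclideanSpace.single 0 (p 0) + EuclideanSpace.single 1 (p 1)
  have h01 : (0 : Fin (m + 2)) ≠ 1 := by simp
  have hq0 : q 0 = p 0 := by simp [q]
  have hq1 : q 1 = p 1 := by simp [q]
  have hq : q ∈ Metric.closedBall (0 : Chart m) 1 := by
    rw [mem_closedBall_zero_iff, EuclideanSpace.norm_eq, Real.sqrt_le_one]
    have : ∑ i, ‖q i‖ ^ 2 = p 0 ^ 2 + p 1 ^ 2 := by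
      rw [Fin.sum_univ_succ, Fin.sum_univ_succ, Finset.sum_eq_zero, hq0]
      · rw [show (Fin.succ 0 : Fin (m + 2)) = 1 from rfl, hq1]
        simp
      · intro j _
        have : j.succ.succ ≠ (1 : Fin (m + 2)) := by
          intro h
          exact absurd (congrArg Fin.val h) (by simp)
        simp [q, this]
    rw [this]
    exact (hp.2.trans hδ1).le
  rw [ha p q hq0.symm hq1.symm]
  exact hC q hq

/-! ### Commutation rules -/

section commutation

variable {u v : Chart m → ℝ}

lemma contDiff_lapXY (hu : ContDiff ℝ ∞ u) : ContDiff ℝ ∞ (lapXY u) :=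
  (contDiff_pderiv (contDiff_pderiv hu _) _).add (contDiff_pderiv (contDiff_pderiv hu _) _)

lemma contDiff_lapK (hu : ContDiff ℝ ∞ u) : ContDiff ℝ ∞ (lapK u) :=
  ContDiff.sum fun _ _ => contDiff_pderiv (contDiff_pderiv hu _) _

lemma pderiv_pderiv_add (hu : ContDiff ℝ ∞ u) (hv : ContDiff ℝ ∞ v) (i j : Fin (m + 2)) :
    pderiv i (pderiv j fun p => u p + v p)
      = fun p => pderiv i (pderiv j u) p + pderiv i (pderiv j v) p := by
  have h : pderiv j (fun p => u p + v p) = fun p => pderiv j u p + pderiv j v p := by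
    ext p
    exact pderiv_add_apply (differentiableAt_of_smooth hu p) (differentiableAt_of_smooth hv p) j
  ext p
  rw [h, pderiv_add_apply (differentiableAt_of_smooth (contDiff_pderiv hu j) p)
    (differentiableAt_of_smooth (contDiff_pderiv hv j) p)]

lemma lap_add (hu : ContDiff ℝ ∞ u) (hv : ContDiff ℝ ∞ v) :
    lap (fun p => u p + v p) = fun p => lap u p + lap v p := by
  ext p
  simp only [lap, pderiv_pderiv_add hu hv, Finset.sum_add_distrib]

lemma lapK_add (hu : ContDiff ℝ ∞ u) (hv : ContDiff ℝ ∞ v) :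
    lapK (fun p => u p + v p) = fun p => lapK u p + lapK v p := by
  ext p
  simp only [lapK, pderiv_pderiv_add hu hv, Finset.sum_add_distrib]

lemma pderiv_lap (hu : ContDiff ℝ ∞ u) (i : Fin (m + 2)) :
    pderiv i (lap u) = lap (pderiv i u) := by
  ext p
  rw [show lap u = fun q => ∑ j, pderiv j (pderiv j u) q from rfl, pderiv_sum_apply _ fun j _ =>
    differentiableAt_of_smooth (contDiff_pderiv (contDiff_pderiv hu j) j) p]
  refine Finset.sum_congr rfl fun j _ => ?_
  rw [pderiv_comm (contDiff_pderiv hu j), pderiv_comm hu]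

lemma pderiv_lapK (hu : ContDiff ℝ ∞ u) (i : Fin (m + 2)) :
    pderiv i (lapK u) = lapK (pderiv i u) := by
  ext p
  rw [show lapK u = fun q => ∑ j : Fin m, pderiv j.succ.succ (pderiv j.succ.succ u) q from rfl,
    pderiv_sum_apply _ fun j _ => differentiableAt_of_smooth
      (contDiff_pderiv (contDiff_pderiv hu j.succ.succ) j.succ.succ) p]
  refine Finset.sum_congr rfl fun j _ => ?_
  rw [pderiv_comm (contDiff_pderiv hu _), pderiv_comm hu]

lemma lapXY_lapK (hu : ContDiff ℝ ∞ u) : lapXY (lapK u) = lapK (lapXY u) := by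
  have h : lapK (lapXY u) = fun p => lapK (pderiv 0 (pderiv 0 u)) p
      + lapK (pderiv 1 (pderiv 1 u)) p :=
    lapK_add (contDiff_pderiv (contDiff_pderiv hu _) _) (contDiff_pderiv (contDiff_pderiv hu _) _)
  rw [h]
  ext p
  simp only [lapXY, pderiv_lapK hu, pderiv_lapK (contDiff_pderiv hu _)]

lemma pderiv_dependsOnXY_mul {a : Chart m → ℝ} (ha : DependsOnXY a) (has : ContDiff ℝ ∞ a)
    (hu : ContDiff ℝ ∞ u) (j : Fin m) :
    pderiv j.succ.succ (fun p => a p * u p) = fun p => a p * pderiv j.succ.succ u p := by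
  ext p
  rw [pderiv_mul_apply (differentiableAt_of_smooth has p) (differentiableAt_of_smooth hu p),
    ha.pderiv_eq_zero j p (differentiableAt_of_smooth has p)]
  ring

lemma lapK_dependsOnXY_mul {a : Chart m → ℝ} (ha : DependsOnXY a) (has : ContDiff ℝ ∞ a)
    (hu : ContDiff ℝ ∞ u) : lapK (fun p => a p * u p) = fun p => a p * lapK u p := by
  ext p
  simp only [lapK, Finset.mul_sum]
  refine Finset.sum_congr rfl fun j _ => ?_
  rw [pderiv_dependsOnXY_mul ha has hu, pderiv_dependsOnXY_mul ha has (contDiff_pderiv hu _)]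

/-- The coefficient `a` does not involve `κ`, so differentiating the equation along `K` produces no
commutator. -/
lemma lapNeck_lapK (hδ : 0 < δ) (hu : ContDiff ℝ ∞ u) :
    lapNeck δ (lapK u) = lapK (lapNeck δ u) := by
  have h : lapK (lapNeck δ u) = fun p => lapK (fun q => invConf m δ q * lapXY u q) p
      + lapK (lapK u) p :=
    lapK_add ((contDiff_invConf hδ).mul (contDiff_lapXY hu)) (contDiff_lapK hu)
  rw [h, lapK_dependsOnXY_mul dependsOnXY_invConf (contDiff_invConf hδ) (contDiff_lapXY hu)]
  ext p
  simp only [lapNeck, lapXY_lapK hu]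

end commutation

/-! ### Radial weights and Hardy's inequality -/

/-- The function `x² + y²`. -/
def radSq (p : Chart m) : ℝ := p 0 ^ 2 + p 1 ^ 2

lemma contDiff_radSq : ContDiff ℝ ∞ (radSq (m := m)) :=
  ((contDiff_coord 0).pow 2).add ((contDiff_coord 1).pow 2)

lemma radSq_pos (hδ : 0 < δ) {p : Chart m} (hp : p ∈ neck m δ) : 0 < radSq p :=
  lt_trans (by positivity) hp.1

lemma pderiv_radSq (i : Fin (m + 2)) (p : Chart m) :
    pderiv i radSq p = 2 * p 0 * (if i = 0 then 1 else 0) + 2 * p 1 * (if i = 1 then 1 else 0) := by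
  have h (k : Fin (m + 2)) : pderiv i (fun q : Chart m => q k ^ 2) p
      = 2 * p k * (if i = k then 1 else 0) := by
    rw [pderiv_comp_apply (u := fun q : Chart m => q k) (g := fun t => t ^ 2)
      (hasDerivAt_pow 2 (p k)) (differentiableAt_of_smooth (contDiff_coord k) p), pderiv_coord]
    simp
  rw [← h 0, ← h 1, ← pderiv_add_apply]
  · rfl
  · exact differentiableAt_of_smooth ((contDiff_coord 0).pow 2) p
  · exact differentiableAt_of_smooth ((contDiff_coord 1).pow 2) p

lemma contDiffAt_inv_radSq_pow {p : Chart m} (hp : radSq p ≠ 0) (k : ℕ) :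
    ContDiffAt ℝ ∞ (fun q => (radSq q ^ k)⁻¹) p :=
  (contDiff_radSq.contDiffAt.pow k).inv (pow_ne_zero _ hp)

lemma pderiv_inv_radSq_pow {p : Chart m} (hp : radSq p ≠ 0) (k : ℕ) (i : Fin (m + 2)) :
    pderiv i (fun q => (radSq q ^ (k + 1))⁻¹) p
      = -(k + 1) * (radSq p ^ (k + 2))⁻¹ * pderiv i radSq p := by
  refine pderiv_comp_apply (u := radSq) (g := fun t => (t ^ (k + 1))⁻¹) ?_
    (differentiableAt_of_smooth contDiff_radSq p) i
  refine ((hasDerivAt_pow (k + 1) (radSq p)).fun_inv (pow_ne_zero _ hp)).congr_deriv ?_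
  rw [Nat.add_sub_cancel]
  push_cast
  field_simp
  ring

namespace IsTest

variable {u : Chart m → ℝ}

lemma inv_radSq_pow_mul (hδ : 0 < δ) (hu : IsTest m δ u) (k : ℕ) :
    IsTest m δ (fun p => (radSq p ^ k)⁻¹ * u p) :=
  hu.mul_left_of_contDiffAt fun _ hp => contDiffAt_inv_radSq_pow (radSq_pos hδ hp).ne' k

/-- The sum over `i = 0, 1` is the divergence of the weighted radial field `r⁻²⁽ᵏ⁺¹⁾ u² (x, y)`. Its
integral vanishes, which is the source of `hardy`. -/
lemma pderiv_hardy_field (hδ : 0 < δ) (hu : IsTest m δ u) (k : ℕ) {p : Chart m}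
    (hp : p ∈ neck m δ) (i : Fin (m + 2)) :
    NeckEstimate.pderiv i (fun q => (radSq q ^ (k + 1))⁻¹ * (q i * u q ^ 2)) p
      = -(k + 1) * (radSq p ^ (k + 2))⁻¹ * NeckEstimate.pderiv i radSq p * (p i * u p ^ 2)
        + (radSq p ^ (k + 1))⁻¹ *
          (u p ^ 2 + p i * (2 * u p * NeckEstimate.pderiv i u p)) := by
  have hr := (radSq_pos hδ hp).ne'
  have hc : DifferentiableAt ℝ (fun q : Chart m => q i) p :=
    differentiableAt_of_smooth (contDiff_coord i) p
  rw [pderiv_mul_apply ((contDiffAt_inv_radSq_pow hr _).differentiableAt (by simp))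
    (hc.fun_mul (hu.sq.diff p)), pderiv_inv_radSq_pow hr, pderiv_mul_apply hc (hu.sq.diff p),
    pderiv_coord, pderiv_comp_apply (u := u) (g := fun t => t ^ 2) (hasDerivAt_pow 2 (u p))
      (hu.diff p)]
  simp

/-- Hardy's inequality with the weights `r⁻²ᵏ`, `k ≥ 2`. -/
lemma hardy (hδ : 0 < δ) (hu : IsTest m δ u) (k : ℕ) :
    ∫ p, (radSq p ^ (k + 2))⁻¹ * u p ^ 2
      ≤ ∫ p, (radSq p ^ (k + 1))⁻¹ *
        (NeckEstimate.pderiv 0 u p ^ 2 + NeckEstimate.pderiv 1 u p ^ 2) := by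
  have hF (i : Fin (m + 2)) : IsTest m δ fun q => (radSq q ^ (k + 2))⁻¹ * (q i * u q ^ 2) :=
    (hu.sq.smooth_mul (contDiff_coord i)).inv_radSq_pow_mul hδ _
  have h0 := (hF 0).integral_pderiv 0
  have h1 := (hF 1).integral_pderiv 1
  have hG := (((hu.pderiv 0).sq.add (hu.pderiv 1).sq).inv_radSq_pow_mul hδ (k + 1)).integrable
  have hI0 := ((hF 0).pderiv 0).integrable
  have hI1 := ((hF 1).pderiv 1).integrable
  have hI : Integrable fun p =>
      NeckEstimate.pderiv 0 (fun q => (radSq q ^ (k + 2))⁻¹ * (q 0 * u q ^ 2)) p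
        + NeckEstimate.pderiv 1 (fun q => (radSq q ^ (k + 2))⁻¹ * (q 1 * u q ^ 2)) p := hI0.add hI1
  have key : ∫ p, (radSq p ^ (k + 2))⁻¹ * u p ^ 2 ≤ ∫ p, ((radSq p ^ (k + 1))⁻¹ *
        (NeckEstimate.pderiv 0 u p ^ 2 + NeckEstimate.pderiv 1 u p ^ 2)
      - (NeckEstimate.pderiv 0 (fun q => (radSq q ^ (k + 2))⁻¹ * (q 0 * u q ^ 2)) p
        + NeckEstimate.pderiv 1 (fun q => (radSq q ^ (k + 2))⁻¹ * (q 1 * u q ^ 2)) p)) := by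
    refine integral_mono (hu.sq.inv_radSq_pow_mul hδ _).integrable (hG.sub hI)
      fun p => ?_
    dsimp only
    by_cases hp : p ∈ neck m δ
    · rw [hu.pderiv_hardy_field hδ (k + 1) hp, hu.pderiv_hardy_field hδ (k + 1) hp,
        pderiv_radSq, pderiv_radSq]
      have hr := radSq_pos hδ hp
      have e1 : (radSq p ^ (k + 1))⁻¹ = radSq p * (radSq p ^ (k + 2))⁻¹ := by field_simp; ring
      have e2 : (radSq p ^ (k + 2))⁻¹ = radSq p * (radSq p ^ (k + 3))⁻¹ := by field_simp; ring
      have hw : 0 ≤ (radSq p ^ (k + 2))⁻¹ := by positivity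
      have hs : p 0 ^ 2 + p 1 ^ 2 = radSq p := rfl
      simp only [show k + 1 + 2 = k + 3 from rfl, show k + 1 + 1 = k + 2 from rfl, zero_ne_one,
        one_ne_zero, if_true, if_false, mul_one, mul_zero, add_zero, zero_add, e1]
      have e3 : (-(((k + 1 : ℕ) : ℝ) + 1) * (radSq p ^ (k + 3))⁻¹ * (2 * p 0) * (p 0 * u p ^ 2))
          + (-(((k + 1 : ℕ) : ℝ) + 1) * (radSq p ^ (k + 3))⁻¹ * (2 * p 1) * (p 1 * u p ^ 2))
          = -(2 * k + 4) * ((radSq p ^ (k + 2))⁻¹ * u p ^ 2) := by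
        rw [e2, ← hs]; push_cast; ring
      -- The bracket is `r²|∇u|² - 2u (x ∂ₓu + y ∂ᵧu) + (2k + 1) u²`, with `∇` the gradient in `x,
      -- y`. Splitting `r²|∇u|²` into its radial and angular squares leaves the square of `u - (x
      -- ∂ₓu + y ∂ᵧu)` plus nonnegative terms.
      have e4 : 0 ≤ (radSq p ^ (k + 2))⁻¹ * (
          radSq p * (NeckEstimate.pderiv 0 u p ^ 2 + NeckEstimate.pderiv 1 u p ^ 2)
          + (2 * k + 4) * u p ^ 2 - 2 * u p ^ 2 - (p 0 * (2 * u p * NeckEstimate.pderiv 0 u p))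
          - (p 1 * (2 * u p * NeckEstimate.pderiv 1 u p)) - u p ^ 2) := by
        refine mul_nonneg hw ?_
        rw [← hs]
        have hk : 0 ≤ (k : ℝ) * u p ^ 2 := by positivity
        nlinarith [sq_nonneg (p 0 * NeckEstimate.pderiv 1 u p - p 1 * NeckEstimate.pderiv 0 u p),
          sq_nonneg (u p - (p 0 * NeckEstimate.pderiv 0 u p + p 1 * NeckEstimate.pderiv 1 u p))]
      linarith
    · rw [hu.eq_zero hp, ((hF 0).pderiv 0).eq_zero hp, ((hF 1).pderiv 1).eq_zero hp,
        (hu.pderiv 0).eq_zero hp, (hu.pderiv 1).eq_zero hp]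
      simp
  rw [integral_sub hG hI, integral_add hI0 hI1, h0, h1] at key
  simpa using key

end IsTest

/-! ### The conformal factor -/

/-- The conformal factor `1 + δ⁴ / (4r⁴)`. -/
def conf (m : ℕ) (δ : ℝ) (p : Chart m) : ℝ := 1 + δ ^ 4 / 4 * (radSq p ^ 2)⁻¹

lemma conf_mul_invConf {p : Chart m} (hp : 0 < radSq p) :
    conf m δ p * invConf m δ p = 1 := by
  have h : invConf m δ p = 4 * radSq p ^ 2 / (4 * radSq p ^ 2 + δ ^ 4) := rfl
  have hd : 0 ≤ δ ^ 4 := by positivity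
  rw [h, conf]
  field_simp

lemma conf_bounds (hδ : 0 < δ) {p : Chart m} (hp : p ∈ neck m δ) :
    1 ≤ conf m δ p ∧ conf m δ p ≤ 5 / 4 := by
  have h1 := invConf_bounds hδ hp
  have h2 := conf_mul_invConf (δ := δ) (radSq_pos hδ hp)
  constructor <;> nlinarith

lemma contDiffAt_conf (hδ : 0 < δ) {p : Chart m} (hp : p ∈ neck m δ) :
    ContDiffAt ℝ ∞ (conf m δ) p :=
  contDiffAt_const.add (contDiffAt_const.mul (contDiffAt_inv_radSq_pow (radSq_pos hδ hp).ne' 2))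

lemma pderiv_conf {p : Chart m} (hp : radSq p ≠ 0) (i : Fin (m + 2)) :
    pderiv i (conf m δ) p = -(δ ^ 4 / 2) * ((radSq p ^ 3)⁻¹ * pderiv i radSq p) := by
  have h := (contDiffAt_inv_radSq_pow hp 2).differentiableAt (by simp)
  rw [show conf m δ = fun q => 1 + δ ^ 4 / 4 * (radSq q ^ 2)⁻¹ from rfl,
    pderiv_add_apply (differentiableAt_const _) (h.const_mul _), pderiv_const_mul_apply h,
    pderiv_inv_radSq_pow hp 1]
  simp only [pderiv, fderiv_fun_const]
  norm_num
  ring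

lemma pderiv_conf_of_eq {p : Chart m} (hp : radSq p ≠ 0) {i : Fin (m + 2)} (hi : i = 0 ∨ i = 1) :
    pderiv i (conf m δ) p = -δ ^ 4 * ((radSq p ^ 3)⁻¹ * p i) := by
  rw [pderiv_conf hp, pderiv_radSq]
  rcases hi with rfl | rfl <;> simp <;> ring

lemma pderiv_pderiv_conf {p : Chart m} (hδ : 0 < δ) (hp : p ∈ neck m δ) {i : Fin (m + 2)}
    (hi : i = 0 ∨ i = 1) :
    pderiv i (pderiv i (conf m δ)) p
      = δ ^ 4 * (6 * (radSq p ^ 4)⁻¹ * p i ^ 2 - (radSq p ^ 3)⁻¹) := by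
  have hr := (radSq_pos hδ hp).ne'
  have e : pderiv i (conf m δ) =ᶠ[nhds p] fun q => -δ ^ 4 * ((radSq q ^ 3)⁻¹ * q i) := by
    filter_upwards [(isOpen_neck m δ).mem_nhds hp] with q hq
    exact pderiv_conf_of_eq (radSq_pos hδ hq).ne' hi
  have h := (contDiffAt_inv_radSq_pow hr 3).differentiableAt (by simp)
  have hc : DifferentiableAt ℝ (fun q : Chart m => q i) p :=
    differentiableAt_of_smooth (contDiff_coord i) p
  rw [pderiv_congr e, pderiv_const_mul_apply (h.fun_mul hc), pderiv_mul_apply h hc,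
    pderiv_inv_radSq_pow hr 2, pderiv_radSq, pderiv_coord]
  rcases hi with rfl | rfl <;> simp <;> ring

/-! ### The fourth-order estimate for test functions -/

lemma pderiv_pderiv_conf_mul {u : Chart m → ℝ} (hu : ContDiff ℝ ∞ u) (hδ : 0 < δ) {p : Chart m}
    (hp : p ∈ neck m δ) (i : Fin (m + 2)) :
    pderiv i (pderiv i fun q => conf m δ q * u q) p
      = pderiv i (pderiv i (conf m δ)) p * u p + 2 * (pderiv i (conf m δ) p * pderiv i u p)
        + conf m δ p * pderiv i (pderiv i u) p := by
  have e : pderiv i (fun q => conf m δ q * u q) =ᶠ[nhds p]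
      fun q => pderiv i (conf m δ) q * u q + conf m δ q * pderiv i u q := by
    filter_upwards [(isOpen_neck m δ).mem_nhds hp] with q hq
    exact pderiv_mul_apply ((contDiffAt_conf hδ hq).differentiableAt (by simp))
      (differentiableAt_of_smooth hu q) i
  have hc := contDiffAt_conf hδ hp
  have d0 : DifferentiableAt ℝ (conf m δ) p := hc.differentiableAt (by simp)
  have d1 : DifferentiableAt ℝ (pderiv i (conf m δ)) p :=
    ((hc.fderiv_right (m := ∞) le_rfl).clm_apply contDiffAt_const).differentiableAt (by simp)
  have d2 := differentiableAt_of_smooth hu p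
  have d3 := differentiableAt_of_smooth (contDiff_pderiv hu i) p
  rw [pderiv_congr e, pderiv_add_apply (d1.fun_mul d2) (d0.fun_mul d3), pderiv_mul_apply d1 d2,
    pderiv_mul_apply d0 d3]
  ring

namespace IsTest

variable {u v : Chart m → ℝ}

lemma sqNorm_lapK_add_lapXY_le (hu : IsTest m δ u) :
    sqNorm (NeckEstimate.lapXY u) + sqNorm (NeckEstimate.lapK u)
      ≤ sqNorm (NeckEstimate.lap u) := by
  have hA := hu.lapXY.sq.integrable
  have hB := hu.lapK.sq.integrable
  have hAB := (hu.lapXY.mul hu.lapK).integrable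
  have e : sqNorm (NeckEstimate.lap u) = ∫ p, ((NeckEstimate.lapXY u p ^ 2
      + NeckEstimate.lapK u p ^ 2)
      + 2 * (NeckEstimate.lapXY u p * NeckEstimate.lapK u p)) := by
    simp only [sqNorm, lap_apply]
    congr 1; ext p; ring
  rw [e, integral_add (hu.lapXY.sq.add hu.lapK.sq).integrable (hAB.const_mul 2), integral_add hA hB, integral_const_mul]
  have := hu.integral_lapXY_mul_lapK_nonneg
  simp only [sqNorm]
  linarith

lemma sqNorm_lapXY_le (hu : IsTest m δ u) :
    sqNorm (NeckEstimate.lapXY u) ≤ sqNorm (NeckEstimate.lap u) := by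
  linarith [hu.sqNorm_lapK_add_lapXY_le, sqNorm_nonneg (NeckEstimate.lapK u)]

lemma sqNorm_lapK_le (hu : IsTest m δ u) :
    sqNorm (NeckEstimate.lapK u) ≤ sqNorm (NeckEstimate.lap u) := by
  linarith [hu.sqNorm_lapK_add_lapXY_le, sqNorm_nonneg (NeckEstimate.lapXY u)]

/-- Hardy's inequality for `∂ᵢu` turns the weight `r⁻¹⁰` into `r⁻⁸` on second derivatives, and `δ⁸
r⁻⁸ ≤ 1` on the neck. -/
lemma weighted_hardy_pderiv (hδ : 0 < δ) (hu : IsTest m δ u) (i : Fin (m + 2)) :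
    δ ^ 8 * ∫ p, (radSq p ^ 5)⁻¹ * NeckEstimate.pderiv i u p ^ 2
      ≤ 2 * sqNorm (NeckEstimate.lap u) := by
  have h0 := ((hu.pderiv i).pderiv 0).sq
  have h1 := ((hu.pderiv i).pderiv 1).sq
  have h2 : ∫ p, δ ^ 8 * ((radSq p ^ 4)⁻¹ *
      (NeckEstimate.pderiv 0 (NeckEstimate.pderiv i u) p ^ 2
        + NeckEstimate.pderiv 1 (NeckEstimate.pderiv i u) p ^ 2))
      ≤ ∫ p, (NeckEstimate.pderiv 0 (NeckEstimate.pderiv i u) p ^ 2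
        + NeckEstimate.pderiv 1 (NeckEstimate.pderiv i u) p ^ 2) := by
    refine integral_mono (((h0.add h1).inv_radSq_pow_mul hδ 4).const_mul _).integrable
      (h0.add h1).integrable fun p => ?_
    dsimp only
    by_cases hp : p ∈ neck m δ
    · have hr := radSq_pos hδ hp
      have hw : δ ^ 8 * (radSq p ^ 4)⁻¹ ≤ 1 := by
        rw [← div_eq_mul_inv, div_le_one (by positivity)]
        calc δ ^ 8 = (δ ^ 2) ^ 4 := by ring
          _ ≤ radSq p ^ 4 := pow_le_pow_left₀ (by positivity) hp.1.le 4
      rw [← mul_assoc]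
      exact mul_le_of_le_one_left (by positivity) hw
    · rw [((hu.pderiv i).pderiv 0).eq_zero hp, ((hu.pderiv i).pderiv 1).eq_zero hp]
      simp
  rw [integral_const_mul, integral_add h0.integrable h1.integrable] at h2
  have h3 := mul_le_mul_of_nonneg_left ((hu.pderiv i).hardy hδ 3) (show 0 ≤ δ ^ 8 by positivity)
  have h4 := hu.sqNorm_pderiv_pderiv_le_lap 0 i
  have h5 := hu.sqNorm_pderiv_pderiv_le_lap 1 i
  simp only [sqNorm] at h4 h5 ⊢
  norm_num at h3
  linarith

/-- The derivatives of `conf` are not bounded uniformly in `δ`; Hardy compensates. The gradient term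
needs `weighted_hardy_pderiv`, the zeroth-order term one further use of `hardy`. The total is `75/16
+ 48 + 192 < 250`. -/
lemma sqNorm_lapXY_conf_mul_le (hδ : 0 < δ) (hu : IsTest m δ u) :
    sqNorm (NeckEstimate.lapXY fun p => conf m δ p * u p)
      ≤ 250 * sqNorm (NeckEstimate.lap u) := by
  have hcu : IsTest m δ fun p => conf m δ p * u p :=
    hu.mul_left_of_contDiffAt fun p hp => contDiffAt_conf hδ hp
  -- The square of a three-term sum costs a factor `3`, so the coefficients are `3·(5/4)²`, `3·2²`
  -- and `3·4²`.
  have I0 := hu.lapXY.sq.const_mul (75 / 16)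
  have I1 := ((((hu.pderiv 0).sq).inv_radSq_pow_mul hδ 5).const_mul (12 * δ ^ 8))
  have I2 := ((((hu.pderiv 1).sq).inv_radSq_pow_mul hδ 5).const_mul (12 * δ ^ 8))
  have I3 := ((hu.sq).inv_radSq_pow_mul hδ 6).const_mul (48 * δ ^ 8)
  have key := hcu.lapXY.sqNorm_le_of_sq_le (((I0.add I1).add I2).add I3).integrable fun p => by
    by_cases hp : p ∈ neck m δ
    · have hr := radSq_pos hδ hp
      -- Product rule, with `∇conf = -δ⁴ r⁻⁶ (x, y)` and `Δ_xy conf = 4 δ⁴ r⁻⁶`.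
      have e : NeckEstimate.lapXY (fun p => conf m δ p * u p) p
          = conf m δ p * NeckEstimate.lapXY u p
            - 2 * δ ^ 4 * (radSq p ^ 3)⁻¹ * (p 0 * NeckEstimate.pderiv 0 u p
              + p 1 * NeckEstimate.pderiv 1 u p)
            + 4 * δ ^ 4 * (radSq p ^ 3)⁻¹ * u p := by
        simp only [NeckEstimate.lapXY]
        rw [pderiv_pderiv_conf_mul hu.1 hδ hp, pderiv_pderiv_conf_mul hu.1 hδ hp,
          pderiv_pderiv_conf hδ hp (Or.inl rfl), pderiv_pderiv_conf hδ hp (Or.inr rfl),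
          pderiv_conf_of_eq hr.ne' (Or.inl rfl), pderiv_conf_of_eq hr.ne' (Or.inr rfl)]
        have e3 : (radSq p ^ 3)⁻¹ = radSq p * (radSq p ^ 4)⁻¹ := by field_simp
        have hs : radSq p = p 0 ^ 2 + p 1 ^ 2 := rfl
        have e4 : (p 0 ^ 2 + p 1 ^ 2) * (radSq p ^ 4)⁻¹ = (radSq p ^ 3)⁻¹ := by
          rw [e3, ← hs]
        linear_combination (6 * δ ^ 4 * u p) * e4
      rw [e]
      obtain ⟨c1, c2⟩ := conf_bounds hδ hp
      generalize conf m δ p = c at c1 c2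
      generalize NeckEstimate.lapXY u p = A
      have e6 : (radSq p ^ 6)⁻¹ = (radSq p ^ 3)⁻¹ ^ 2 := by field_simp
      have e5 : (radSq p ^ 5)⁻¹ = (p 0 ^ 2 + p 1 ^ 2) * (radSq p ^ 3)⁻¹ ^ 2 := by
        rw [show p 0 ^ 2 + p 1 ^ 2 = radSq p from rfl]; field_simp
      rw [e5, e6]
      generalize (radSq p ^ 3)⁻¹ = w
      generalize NeckEstimate.pderiv 0 u p = a
      generalize NeckEstimate.pderiv 1 u p = b
      generalize u p = z
      generalize p 0 = x
      generalize p 1 = y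
      have hA : (c * A) ^ 2 ≤ 25 / 16 * A ^ 2 := by
        rw [mul_pow]
        exact mul_le_mul_of_nonneg_right (by nlinarith) (sq_nonneg A)
      have hB : (2 * δ ^ 4 * w * (x * a + y * b)) ^ 2
          ≤ 4 * δ ^ 8 * ((x ^ 2 + y ^ 2) * w ^ 2 * a ^ 2)
            + 4 * δ ^ 8 * ((x ^ 2 + y ^ 2) * w ^ 2 * b ^ 2) := by
        nlinarith [sq_nonneg (δ ^ 4 * w * (x * b - y * a))]
      have hC (r s t : ℝ) : (r - s + t) ^ 2 ≤ 3 * (r ^ 2 + s ^ 2 + t ^ 2) := by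
        nlinarith [sq_nonneg (r + s), sq_nonneg (r - t), sq_nonneg (s + t)]
      refine (hC _ _ _).trans ?_
      have hD : (4 * δ ^ 4 * w * z) ^ 2 = 16 * δ ^ 8 * (w ^ 2 * z ^ 2) := by ring
      rw [hD]
      linarith
    · rw [hcu.lapXY.eq_zero hp, hu.lapXY.eq_zero hp, hu.eq_zero hp, (hu.pderiv 0).eq_zero hp,
        (hu.pderiv 1).eq_zero hp]
      simp
  rw [integral_add ((I0.add I1).add I2).integrable I3.integrable,
    integral_add (I0.add I1).integrable I2.integrable, integral_add I0.integrable I1.integrable,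
    integral_const_mul, integral_const_mul, integral_const_mul, integral_const_mul] at key
  have hh := hu.hardy hδ 4
  simp only [Nat.reduceAdd, mul_add] at hh
  rw [integral_add (((hu.pderiv 0).sq).inv_radSq_pow_mul hδ 5).integrable
    (((hu.pderiv 1).sq).inv_radSq_pow_mul hδ 5).integrable] at hh
  have hh' := mul_le_mul_of_nonneg_left hh (show 0 ≤ δ ^ 8 by positivity)
  have h0 := hu.weighted_hardy_pderiv hδ 0
  have h1 := hu.weighted_hardy_pderiv hδ 1
  have h2 := hu.sqNorm_lapXY_le
  have h3 := sqNorm_nonneg (NeckEstimate.lap u)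
  simp only [sqNorm] at *
  linarith

/-- The fourth-order estimate, uniform in `δ`. -/
lemma sqNorm_lap_lap_le (hδ : 0 < δ) (hu : IsTest m δ u) :
    sqNorm (NeckEstimate.lap (NeckEstimate.lap u))
      ≤ 10000 * sqNorm (NeckEstimate.lap (NeckEstimate.lapNeck δ u)) := by
  have hA := hu.lapXY
  have hB := hu.lapK
  have hψ := hu.lapNeck hδ
  have hw : IsTest m δ fun p => NeckEstimate.lapNeck δ u p + (-1) * NeckEstimate.lapK u p :=
    hψ.add (hB.const_mul _)
  -- The equation solved for `Δ_xy u`; off the neck both sides vanish.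
  have eA : (fun p => conf m δ p *
      (NeckEstimate.lapNeck δ u p + (-1) * NeckEstimate.lapK u p)) = NeckEstimate.lapXY u := by
    ext p
    by_cases hp : p ∈ neck m δ
    · simp only [NeckEstimate.lapNeck]
      linear_combination NeckEstimate.lapXY u p * conf_mul_invConf (δ := δ) (radSq_pos hδ hp)
    · rw [hw.eq_zero hp, hA.eq_zero hp, mul_zero]
  have hAA := hw.sqNorm_lapXY_conf_mul_le hδ
  rw [eA] at hAA
  have hlapw : NeckEstimate.lap (fun p => NeckEstimate.lapNeck δ u p + (-1) * NeckEstimate.lapK u p)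
      = fun p => NeckEstimate.lap (NeckEstimate.lapNeck δ u) p
        - NeckEstimate.lap (NeckEstimate.lapK u) p := by
    have h2 : NeckEstimate.lap (fun p => (-1) * NeckEstimate.lapK u p)
        = fun p => (-1) * NeckEstimate.lap (NeckEstimate.lapK u) p := by
      ext p
      have h3 (v : Chart m → ℝ) (hv : ContDiff ℝ ∞ v) (j : Fin (m + 2)) :
          NeckEstimate.pderiv j (fun p => (-1) * v p)
            = fun p => (-1) * NeckEstimate.pderiv j v p := by
        ext q
        exact pderiv_const_mul_apply (differentiableAt_of_smooth hv q) _ _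
      simp only [NeckEstimate.lap, Finset.mul_sum]
      refine Finset.sum_congr rfl fun j _ => ?_
      rw [h3 _ hB.1, h3 _ (contDiff_pderiv hB.1 j)]
    rw [lap_add hψ.1 (hB.const_mul (-1)).1, h2]
    ext p; ring
  -- The second-order estimate is applied to `Δ_K u`, whose image under `Δ_δ` is `Δ_K Δ_δ u`.
  have hLB := hB.sqNorm_lap_le hδ
  rw [lapNeck_lapK hδ hu.1] at hLB
  have hKψ := hψ.sqNorm_lapK_le
  have hlw := hψ.lap.sqNorm_sub_le hB.lap
  rw [← hlapw] at hlw
  have hAB := hB.sqNorm_lapXY_le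
  have hnn := sqNorm_nonneg (NeckEstimate.lap (NeckEstimate.lapNeck δ u))
  have eL : NeckEstimate.lap (NeckEstimate.lap u) = fun p =>
      (NeckEstimate.lapXY (NeckEstimate.lapXY u) p + NeckEstimate.lapXY (NeckEstimate.lapK u) p)
        + NeckEstimate.lap (NeckEstimate.lapK u) p := by
    have h : NeckEstimate.lap u = fun p => NeckEstimate.lapXY u p + NeckEstimate.lapK u p :=
      funext (lap_apply u)
    rw [h, lap_add hA.1 hB.1]
    ext p
    rw [lap_apply (NeckEstimate.lapXY u), lapXY_lapK hu.1]
  rw [eL]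
  have h1 := (hA.lapXY.add hB.lapXY).sqNorm_add_le hB.lap
  have h2 := hA.lapXY.sqNorm_add_le hB.lapXY
  -- The squared norm of `Δ_xy²u` costs `250·(2 + 4) = 1500`, the other two terms `2` each; the two
  -- splittings give `2(2·1500 + 2·2) + 2·2 = 6012`.
  linarith

end IsTest

/-! ### Iterated derivatives -/

/-- The iterated derivative along a list of coordinate directions. -/
def listDeriv (l : List (Fin (m + 2))) (u : Chart m → ℝ) : Chart m → ℝ :=
  l.foldr (fun i g => pderiv i g) u

@[simp] lemma listDeriv_nil (u : Chart m → ℝ) : listDeriv [] u = u := rfl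

@[simp] lemma listDeriv_cons (i : Fin (m + 2)) (l : List (Fin (m + 2))) (u : Chart m → ℝ) :
    listDeriv (i :: l) u = pderiv i (listDeriv l u) := rfl

lemma listDeriv_append (l l' : List (Fin (m + 2))) (u : Chart m → ℝ) :
    listDeriv (l ++ l') u = listDeriv l (listDeriv l' u) := by
  simp [listDeriv]

lemma listDeriv_replicate (i : Fin (m + 2)) (k : ℕ) (u : Chart m → ℝ) :
    listDeriv (List.replicate k i) u = (pderiv i)^[k] u := by
  induction k with
  | zero => rfl
  | succ k ih => rw [List.replicate_succ, listDeriv_cons, ih, Function.iterate_succ_apply']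

lemma contDiff_listDeriv {u : Chart m → ℝ} (hu : ContDiff ℝ ∞ u) (l : List (Fin (m + 2))) :
    ContDiff ℝ ∞ (listDeriv l u) := by
  induction l with
  | nil => exact hu
  | cons i l ih => exact contDiff_pderiv ih i

lemma listDeriv_add (l : List (Fin (m + 2))) {v w : Chart m → ℝ} (hv : ContDiff ℝ ∞ v)
    (hw : ContDiff ℝ ∞ w) :
    listDeriv l (fun p => v p + w p) = fun p => listDeriv l v p + listDeriv l w p := by
  induction l with
  | nil => rfl
  | cons j l ih =>
    ext p
    rw [listDeriv_cons, ih, pderiv_add_apply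
      (differentiableAt_of_smooth (contDiff_listDeriv hv l) p)
      (differentiableAt_of_smooth (contDiff_listDeriv hw l) p)]
    rfl

lemma listDeriv_sub (l : List (Fin (m + 2))) {v w : Chart m → ℝ} (hv : ContDiff ℝ ∞ v)
    (hw : ContDiff ℝ ∞ w) :
    listDeriv l (fun p => v p - w p) = fun p => listDeriv l v p - listDeriv l w p := by
  induction l with
  | nil => rfl
  | cons j l ih =>
    ext p
    rw [listDeriv_cons, ih, pderiv_sub_apply
      (differentiableAt_of_smooth (contDiff_listDeriv hv l) p)
      (differentiableAt_of_smooth (contDiff_listDeriv hw l) p)]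
    rfl

lemma listDeriv_sum {ι : Type*} (s : Finset ι) (l : List (Fin (m + 2))) {w : ι → Chart m → ℝ}
    (hw : ∀ j, ContDiff ℝ ∞ (w j)) :
    listDeriv l (fun p => ∑ j ∈ s, w j p) = fun p => ∑ j ∈ s, listDeriv l (w j) p := by
  induction l with
  | nil => rfl
  | cons i l ih =>
    ext p
    rw [listDeriv_cons, ih, pderiv_sum_apply s fun j _ =>
      differentiableAt_of_smooth (contDiff_listDeriv (hw j) l) p]
    rfl

lemma listDeriv_perm {u : Chart m → ℝ} (hu : ContDiff ℝ ∞ u) {l l' : List (Fin (m + 2))}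
    (h : l.Perm l') : listDeriv l u = listDeriv l' u := by
  induction h with
  | nil => rfl
  | cons i _ ih => rw [listDeriv_cons, listDeriv_cons, ih]
  | swap i j l =>
    simp only [listDeriv_cons]
    exact pderiv_comm (contDiff_listDeriv hu l) _ _
  | trans _ _ h1 h2 => rw [h1, h2]

/-- The list of coordinate directions of a multi-index. -/
def dirList (ν : Fin (m + 2) → ℕ) : List (Fin (m + 2)) :=
  (List.finRange (m + 2)).flatMap fun i => List.replicate (ν i) i

/-- Lists of directions allow induction one derivative at a time, and symmetry of derivatives
becomes invariance under permutation. -/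
lemma multiDeriv_eq_listDeriv (ν : Fin (m + 2) → ℕ) (u : Chart m → ℝ) :
    multiDeriv ν u = listDeriv (dirList ν) u := by
  have (l : List (Fin (m + 2))) : l.foldr (fun i g => (pderiv i)^[ν i] g) u
      = listDeriv (l.flatMap fun i => List.replicate (ν i) i) u := by
    induction l with
    | nil => rfl
    | cons i l ih => rw [List.foldr_cons, ih, List.flatMap_cons, listDeriv_append,
        listDeriv_replicate]
  exact this _

lemma length_dirList (ν : Fin (m + 2) → ℕ) : (dirList ν).length = ∑ i, ν i := by
  rw [dirList, List.length_flatMap]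
  simp only [List.length_replicate]
  rw [← List.ofFn_eq_map, List.sum_ofFn]

lemma count_dirList (ν : Fin (m + 2) → ℕ) (i : Fin (m + 2)) : (dirList ν).count i = ν i := by
  rw [dirList, List.count_flatMap]
  have : (List.count i ∘ fun j => List.replicate (ν j) j)
      = fun j => if j = i then ν j else 0 := by
    ext j
    simp [List.count_replicate]
  rw [this, ← List.ofFn_eq_map, List.sum_ofFn]
  simp

lemma listDeriv_eq_multiDeriv {u : Chart m → ℝ} (hu : ContDiff ℝ ∞ u) (l : List (Fin (m + 2))) :
    listDeriv l u = multiDeriv (fun i => l.count i) u := by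
  rw [multiDeriv_eq_listDeriv]
  refine listDeriv_perm hu (List.perm_iff_count.2 fun i => ?_)
  rw [count_dirList]

lemma sum_count (l : List (Fin (m + 2))) : ∑ i, l.count i = l.length := by
  have h := length_dirList fun i => l.count i
  rw [← h]
  refine List.Perm.length_eq (List.perm_iff_count.2 fun i => ?_)
  rw [count_dirList]

lemma mem_multiIndices {k : ℕ} {ν : Fin (m + 2) → ℕ} :
    ν ∈ multiIndices m k ↔ ∑ i, ν i ≤ k := by
  simp only [multiIndices, Finset.mem_filter, Fintype.mem_piFinset, Finset.mem_range,
    and_iff_right_iff_imp]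
  intro h i
  have := Finset.single_le_sum (f := ν) (fun _ _ => Nat.zero_le _) (Finset.mem_univ i)
  omega

/-- The sum of the squared `L²` norms of the derivatives of order at most `k`. -/
def sobSq (k : ℕ) (u : Chart m → ℝ) : ℝ := ∑ ν ∈ multiIndices m k, sqNorm (multiDeriv ν u)

lemma sqNorm_listDeriv_le_sobSq {u : Chart m → ℝ} (hu : ContDiff ℝ ∞ u) {k : ℕ}
    {l : List (Fin (m + 2))} (hl : l.length ≤ k) : sqNorm (listDeriv l u) ≤ sobSq k u := by
  rw [listDeriv_eq_multiDeriv hu]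
  exact Finset.single_le_sum (f := fun ν => sqNorm (multiDeriv ν u)) (fun ν _ => sqNorm_nonneg _)
    (mem_multiIndices.2 ((sum_count l).trans_le hl))

lemma sobSq_mono (u : Chart m → ℝ) {k k' : ℕ} (h : k ≤ k') : sobSq k u ≤ sobSq k' u :=
  Finset.sum_le_sum_of_subset_of_nonneg
    (fun _ hν => mem_multiIndices.2 ((mem_multiIndices.1 hν).trans h)) fun _ _ _ => sqNorm_nonneg _

lemma sobSq_pderiv_le {u : Chart m → ℝ} (hu : ContDiff ℝ ∞ u) (k : ℕ) (i : Fin (m + 2)) :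
    sobSq k (pderiv i u) ≤ (multiIndices m k).card * sobSq (k + 1) u := by
  rw [← nsmul_eq_mul]
  refine Finset.sum_le_card_nsmul _ _ _ fun ν hν => ?_
  rw [multiDeriv_eq_listDeriv, ← listDeriv_nil (pderiv i u), ← listDeriv_append, List.append_nil,
    ← listDeriv_nil u, ← listDeriv_cons, ← listDeriv_append]
  refine sqNorm_listDeriv_le_sobSq hu ?_
  rw [List.length_append, length_dirList]
  simpa using mem_multiIndices.1 hν

/-! ### Uniform a priori estimates for all derivatives of test functions -/

namespace IsTest

variable {u : Chart m → ℝ}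

lemma listDeriv (hu : IsTest m δ u) (l : List (Fin (m + 2))) : IsTest m δ (listDeriv l u) := by
  induction l with
  | nil => exact hu
  | cons i l ih => exact ih.pderiv i

lemma multiDeriv (hu : IsTest m δ u) (ν : Fin (m + 2) → ℕ) : IsTest m δ (multiDeriv ν u) := by
  rw [multiDeriv_eq_listDeriv]
  exact hu.listDeriv _

/-- Missing orders are filled by derivatives in `x`, each costing the Poincaré factor `4`. -/
lemma sqNorm_listDeriv_le_of_length_le (hδ1 : δ < 1) (hu : IsTest m δ u) {k : ℕ} {K : ℝ}
    (hK : ∀ l : List (Fin (m + 2)), l.length = k → sqNorm (NeckEstimate.listDeriv l u) ≤ K)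
    {l : List (Fin (m + 2))} (hl : l.length ≤ k) :
    sqNorm (NeckEstimate.listDeriv l u) ≤ 4 ^ k * K := by
  have hK0 : 0 ≤ K := (sqNorm_nonneg _).trans (hK (List.replicate k 0) (by simp))
  have h (d : ℕ) : ∀ l : List (Fin (m + 2)), l.length + d = k →
      sqNorm (NeckEstimate.listDeriv l u) ≤ 4 ^ d * K := by
    induction d with
    | zero => intro l hl; simpa using hK l hl
    | succ d ih =>
      intro l hl
      have h1 := (hu.listDeriv l).sqNorm_le_pderiv hδ1
      have h2 := ih (0 :: l) (by simp; omega)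
      rw [listDeriv_cons] at h2
      rw [pow_succ]
      linarith
  refine (h (k - l.length) l (by omega)).trans ?_
  exact mul_le_mul_of_nonneg_right (pow_le_pow_right₀ (by norm_num) (Nat.sub_le _ _)) hK0

lemma sqNorm_multiDeriv_le_two (hδ : 0 < δ) (hδ1 : δ < 1) (hu : IsTest m δ u)
    {ν : Fin (m + 2) → ℕ} (hν : ν ∈ multiIndices m 2) :
    sqNorm (NeckEstimate.multiDeriv ν u) ≤ 32 * sobSq 0 (NeckEstimate.lapNeck δ u) := by
  rw [multiDeriv_eq_listDeriv]
  have h0 := sqNorm_listDeriv_le_sobSq (k := 0) (l := []) (hu.lapNeck hδ).1 le_rfl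
  have h := hu.sqNorm_listDeriv_le_of_length_le hδ1 (k := 2)
    (K := 2 * sobSq 0 (NeckEstimate.lapNeck δ u)) (fun l hl => ?_) (l := dirList ν)
    (by rw [length_dirList]; exact mem_multiIndices.1 hν)
  · linarith
  · obtain ⟨i, j, rfl⟩ := List.length_eq_two.1 hl
    have h1 := hu.sqNorm_pderiv_pderiv_le_lap i j
    have h2 := hu.sqNorm_lap_le hδ
    simp only [listDeriv_cons, listDeriv_nil] at h0 ⊢
    linarith

/-- A fourth derivative `∂ᵢ∂ⱼ∂ₖ∂ₙu` is bounded by `Δ∂ₖ∂ₙu = ∂ₖ∂ₙΔu`, hence by `Δ²u`. The constant is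
`4⁴ · 10000`, and `(m + 2)²` counts the second derivatives making up `‖Δ(Δ_δ u)‖²`. -/
lemma sqNorm_multiDeriv_le_four (hδ : 0 < δ) (hδ1 : δ < 1) (hu : IsTest m δ u)
    {ν : Fin (m + 2) → ℕ} (hν : ν ∈ multiIndices m 4) :
    sqNorm (NeckEstimate.multiDeriv ν u)
      ≤ 2560000 * (m + 2) ^ 2 * sobSq 2 (NeckEstimate.lapNeck δ u) := by
  rw [multiDeriv_eq_listDeriv]
  have hψ := hu.lapNeck hδ
  have h0 : sqNorm (NeckEstimate.lap (NeckEstimate.lapNeck δ u))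
      ≤ (m + 2) ^ 2 * sobSq 2 (NeckEstimate.lapNeck δ u) := by
    rw [hψ.sqNorm_lap]
    have h (i j : Fin (m + 2)) := sqNorm_listDeriv_le_sobSq (k := 2) (l := [i, j]) hψ.1 le_rfl
    refine (Finset.sum_le_sum fun i _ => Finset.sum_le_sum fun j _ => h i j).trans ?_
    simp only [Finset.sum_const, Finset.card_univ, Fintype.card_fin, nsmul_eq_mul]
    push_cast
    linarith
  have h := hu.sqNorm_listDeriv_le_of_length_le hδ1 (k := 4)
    (K := 10000 * ((m + 2) ^ 2 * sobSq 2 (NeckEstimate.lapNeck δ u))) (fun l hl => ?_)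
    (l := dirList ν) (by rw [length_dirList]; exact mem_multiIndices.1 hν)
  · linarith
  · obtain ⟨i, j, k, n, rfl⟩ : ∃ i j k n, l = [i, j, k, n] := by
      match l, hl with
      | [i, j, k, n], _ => exact ⟨i, j, k, n, rfl⟩
    simp only [listDeriv_cons, listDeriv_nil]
    have h1 := ((hu.pderiv n).pderiv k).sqNorm_pderiv_pderiv_le_lap i j
    rw [← pderiv_lap (hu.pderiv n).1, ← pderiv_lap hu.1] at h1
    have h2 := hu.lap.sqNorm_pderiv_pderiv_le_lap k n
    have h3 := hu.sqNorm_lap_lap_le hδ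
    linarith

/-! ### Qualitative bounds -/

/-- Leibniz rule, peeling off the innermost derivative; the quantifier over `a` lets the induction
hypothesis apply to `∂ᵢa` as well. The constant depends on `a`, hence possibly on `δ`; it serves
only for continuity of `Δ_δ` at fixed `δ`. -/
lemma sqNorm_listDeriv_mul_le (hδ1 : δ < 1) (l : List (Fin (m + 2))) :
    ∀ a : Chart m → ℝ, DependsOnXY a → ContDiff ℝ ∞ a → ∃ C : ℝ, 0 ≤ C ∧
      ∀ u, IsTest m δ u →
        sqNorm (NeckEstimate.listDeriv l fun p => a p * u p) ≤ C * sobSq l.length u := by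
  induction l using List.reverseRecOn with
  | nil =>
    intro a ha has
    obtain ⟨C, hC⟩ := ha.exists_bound has.continuous hδ1
    refine ⟨C ^ 2, sq_nonneg _, fun u hu => ?_⟩
    have h1 : sqNorm (fun p => a p * u p) ≤ C ^ 2 * sqNorm u := by
      simp only [sqNorm]
      rw [← integral_const_mul]
      refine integral_mono (hu.smooth_mul has).sq.integrable (hu.sq.integrable.const_mul _)
        fun p => ?_
      dsimp only
      by_cases hp : p ∈ neck m δ
      · rw [mul_pow]
        refine mul_le_mul_of_nonneg_right ?_ (sq_nonneg _)
        rw [← sq_abs (a p)]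
        exact pow_le_pow_left₀ (abs_nonneg _) (hC p hp) 2
      · simp [hu.eq_zero hp]
    exact h1.trans (mul_le_mul_of_nonneg_left
      (sqNorm_listDeriv_le_sobSq (k := 0) (l := []) hu.1 le_rfl) (sq_nonneg _))
  | append_singleton l i ih =>
    intro a ha has
    obtain ⟨C, hC0, hC⟩ := ih a ha has
    obtain ⟨D, hD0, hD⟩ := ih (NeckEstimate.pderiv i a) (ha.pderiv i) (contDiff_pderiv has i)
    refine ⟨2 * D + 2 * (C * (multiIndices m l.length).card), by positivity, fun u hu => ?_⟩
    have e : NeckEstimate.listDeriv (l ++ [i]) (fun p => a p * u p) = fun p =>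
        NeckEstimate.listDeriv l (fun p => NeckEstimate.pderiv i a p * u p) p
        + NeckEstimate.listDeriv l (fun p => a p * NeckEstimate.pderiv i u p) p := by
      rw [listDeriv_append, listDeriv_cons, listDeriv_nil]
      have e1 : NeckEstimate.pderiv i (fun p => a p * u p)
          = fun p => NeckEstimate.pderiv i a p * u p + a p * NeckEstimate.pderiv i u p :=
        funext fun p => pderiv_mul_apply (differentiableAt_of_smooth has p) (hu.diff p) i
      rw [e1]
      exact listDeriv_add l (hu.smooth_mul (contDiff_pderiv has i)).1 ((hu.pderiv i).smooth_mul has).1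
    rw [e]
    have h1 := ((hu.smooth_mul (contDiff_pderiv has i)).listDeriv l).sqNorm_add_le
      (((hu.pderiv i).smooth_mul has).listDeriv l)
    have h2 := hD u hu
    have h3 := hC _ (hu.pderiv i)
    have h4 := mul_le_mul_of_nonneg_left (sobSq_pderiv_le hu.1 l.length i) hC0
    have h5 := mul_le_mul_of_nonneg_left (sobSq_mono u (Nat.le_succ l.length)) hD0
    rw [List.length_append, List.length_singleton]
    simp only [Nat.succ_eq_add_one] at h5
    linarith

end IsTest

/-! ### The diagonal form of the Laplace–Beltrami operator -/

/-- The diagonal coefficients of the inverse metric. -/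
def coeff (m : ℕ) (δ : ℝ) (j : Fin (m + 2)) : Chart m → ℝ :=
  fun p => if j = 0 ∨ j = 1 then invConf m δ p else 1

lemma dependsOnXY_coeff (j : Fin (m + 2)) : DependsOnXY (coeff m δ j) := by
  intro p q h0 h1
  simp only [coeff, dependsOnXY_invConf p q h0 h1]

lemma contDiff_coeff (hδ : 0 < δ) (j : Fin (m + 2)) : ContDiff ℝ ∞ (coeff m δ j) := by
  by_cases hj : j = 0 ∨ j = 1
  · rw [show coeff m δ j = invConf m δ from funext fun p => if_pos hj]
    exact contDiff_invConf hδ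
  · rw [show coeff m δ j = fun _ => 1 from funext fun p => if_neg hj]
    exact contDiff_const

lemma succ_succ_ne (j : Fin m) : ¬(j.succ.succ = (0 : Fin (m + 2)) ∨ j.succ.succ = 1) := by
  rintro (h | h)
  · exact Fin.succ_ne_zero _ h
  · exact absurd (congrArg Fin.val h) (by simp)

lemma lapNeck_eq_sum (u : Chart m → ℝ) :
    lapNeck δ u = fun p => ∑ j, coeff m δ j p * pderiv j (pderiv j u) p := by
  ext p
  rw [Fin.sum_univ_succ, Fin.sum_univ_succ, show (Fin.succ 0 : Fin (m + 2)) = 1 from rfl]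
  simp only [coeff, succ_succ_ne, true_or, or_true, if_true, if_false, one_mul, lapNeck, lapXY,
    lapK]
  ring

lemma exists_sqNorm_multiDeriv_lapNeck_le (hδ : 0 < δ) (hδ1 : δ < 1) {k : ℕ}
    {ν : Fin (m + 2) → ℕ} (hν : ν ∈ multiIndices m k) :
    ∃ C : ℝ, 0 ≤ C ∧ ∀ u, IsTest m δ u →
      sqNorm (multiDeriv ν (lapNeck δ u)) ≤ C * sobSq (k + 2) u := by
  choose C hC0 hC using fun j => IsTest.sqNorm_listDeriv_mul_le (m := m) hδ1 (dirList ν)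
    (coeff m δ j) (dependsOnXY_coeff j) (contDiff_coeff hδ j)
  set N : ℝ := (multiIndices m k).card * (multiIndices m (k + 1)).card with hN
  refine ⟨(m + 2 : ℕ) * ∑ j, C j * N, mul_nonneg (Nat.cast_nonneg _)
    (Finset.sum_nonneg fun j _ => mul_nonneg (hC0 j) (by positivity)), fun u hu => ?_⟩
  have ht (j : Fin (m + 2)) : IsTest m δ fun p => coeff m δ j p * pderiv j (pderiv j u) p :=
    ((hu.pderiv j).pderiv j).smooth_mul (contDiff_coeff hδ j)
  rw [multiDeriv_eq_listDeriv, lapNeck_eq_sum, listDeriv_sum _ _ fun j => (ht j).1]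
  refine (IsTest.sqNorm_sum_le Finset.univ fun j _ => (ht j).listDeriv _).trans ?_
  rw [Finset.card_univ, Fintype.card_fin, mul_assoc, Finset.sum_mul]
  refine mul_le_mul_of_nonneg_left (Finset.sum_le_sum fun j _ => ?_) (by positivity)
  refine (hC j _ ((hu.pderiv j).pderiv j)).trans ?_
  rw [mul_assoc]
  refine mul_le_mul_of_nonneg_left ?_ (hC0 j)
  refine (sobSq_mono _ ((length_dirList ν).trans_le (mem_multiIndices.1 hν))).trans ?_
  refine (sobSq_pderiv_le (hu.pderiv j).1 k j).trans ?_
  rw [hN, mul_assoc]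
  exact mul_le_mul_of_nonneg_left (sobSq_pderiv_le hu.1 (k + 1) j) (by positivity)

lemma lapNeck_sub {u v : Chart m → ℝ} (hu : ContDiff ℝ ∞ u) (hv : ContDiff ℝ ∞ v) :
    lapNeck δ (fun p => u p - v p) = fun p => lapNeck δ u p - lapNeck δ v p := by
  ext p
  simp only [lapNeck_eq_sum, ← Finset.sum_sub_distrib, ← mul_sub]
  refine Finset.sum_congr rfl fun j _ => ?_
  have h := congrFun (listDeriv_sub [j, j] hu hv) p
  simp only [listDeriv_cons, listDeriv_nil] at h
  rw [h]

/-! ### Weak derivatives -/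

/-- Lebesgue measure on the neck. -/
abbrev leb (m : ℕ) (δ : ℝ) : Measure (Chart m) := volume.restrict (neck m δ)

lemma integrable_mul_test {f χ : Chart m → ℝ} (hf : LocallyIntegrableOn f (neck m δ))
    (hχ : IsTest m δ χ) : Integrable (fun p => f p * χ p) := by
  have h := (hf.integrableOn_compact_subset hχ.2.2 hχ.2.1).mul_continuousOn
    hχ.continuous.continuousOn hχ.2.1
  refine (integrableOn_iff_integrable_of_support_subset ?_).1 h
  intro p hp
  exact subset_tsupport _ fun h0 => hp (by simp [h0])

lemma locallyIntegrableOn_of_memLp {f : Chart m → ℝ} (hf : MemLp f 2 (leb m δ)) :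
    LocallyIntegrableOn f (neck m δ) :=
  locallyIntegrableOn_of_locallyIntegrable_restrict (hf.locallyIntegrable (by norm_num))

lemma ae_eq_of_integral_mul_test {f g : Chart m → ℝ} (hf : LocallyIntegrableOn f (neck m δ))
    (hg : LocallyIntegrableOn g (neck m δ))
    (h : ∀ χ, IsTest m δ χ → ∫ p in neck m δ, f p * χ p = ∫ p in neck m δ, g p * χ p) :
    f =ᵐ[leb m δ] g := by
  have h0 := (isOpen_neck m δ).ae_eq_zero_of_integral_contDiff_smul_eq_zero (μ := volume)
    (hf.sub hg) fun χ h1 h2 h3 => by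
      have hχ : IsTest m δ χ := ⟨h1, h2, h3⟩
      have e := h χ hχ
      rw [setIntegral_eq_integral_of_forall_compl_eq_zero fun p hp => by rw [hχ.eq_zero hp, mul_zero],
        setIntegral_eq_integral_of_forall_compl_eq_zero fun p hp => by
          rw [hχ.eq_zero hp, mul_zero]] at e
      have : (fun p => χ p • (f - g) p) = fun p => f p * χ p - g p * χ p := by
        ext p; simp; ring
      rw [this, integral_sub (integrable_mul_test hf hχ) (integrable_mul_test hg hχ), e, sub_self]
  rw [Filter.EventuallyEq, ae_restrict_iff' (isOpen_neck m δ).measurableSet]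
  filter_upwards [h0] with p hp hpn
  exact sub_eq_zero.1 (hp hpn)

lemma HasWeakDeriv.unique {ν : Fin (m + 2) → ℕ} {f g g' : Chart m → ℝ}
    (h : HasWeakDeriv m δ ν f g) (h' : HasWeakDeriv m δ ν f g') : g =ᵐ[leb m δ] g' := by
  refine ae_eq_of_integral_mul_test h.2.1 h'.2.1 fun χ hχ => ?_
  have := (h.2.2 χ hχ).symm.trans (h'.2.2 χ hχ)
  exact mul_left_cancel₀ (pow_ne_zero _ (by norm_num)) this

lemma HasWeakDeriv.weakDeriv {ν : Fin (m + 2) → ℕ} {f g : Chart m → ℝ}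
    (h : HasWeakDeriv m δ ν f g) : HasWeakDeriv m δ ν f (weakDeriv m δ ν f) := by
  have hex : ∃ g, HasWeakDeriv m δ ν f g := ⟨g, h⟩
  rw [NeckEstimate.weakDeriv, dif_pos hex]
  exact hex.choose_spec

lemma HasWeakDeriv.weakDeriv_ae_eq {ν : Fin (m + 2) → ℕ} {f g : Chart m → ℝ}
    (h : HasWeakDeriv m δ ν f g) : NeckEstimate.weakDeriv m δ ν f =ᵐ[leb m δ] g :=
  h.weakDeriv.unique h

lemma HasWeakDeriv.sub {ν : Fin (m + 2) → ℕ} {f f' g g' : Chart m → ℝ}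
    (h : HasWeakDeriv m δ ν f g) (h' : HasWeakDeriv m δ ν f' g') :
    HasWeakDeriv m δ ν (f - f') (g - g') := by
  refine ⟨h.1.sub h'.1, h.2.1.sub h'.2.1, fun χ hχ => ?_⟩
  have hm := hχ.multiDeriv ν
  simp only [Pi.sub_apply, sub_mul]
  rw [integral_sub (integrable_mul_test h.1 hm).integrableOn
    (integrable_mul_test h'.1 hm).integrableOn,
    integral_sub (integrable_mul_test h.2.1 hχ).integrableOn
    (integrable_mul_test h'.2.1 hχ).integrableOn, h.2.2 χ hχ, h'.2.2 χ hχ, mul_sub]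

lemma IsTest.integral_mul_listDeriv {u χ : Chart m → ℝ} (hu : IsTest m δ u)
    (hχ : ContDiff ℝ ∞ χ) (l : List (Fin (m + 2))) :
    ∫ p, u p * NeckEstimate.listDeriv l χ p
      = (-1) ^ l.length * ∫ p, NeckEstimate.listDeriv l u p * χ p := by
  induction l generalizing u with
  | nil => simp
  | cons i l ih =>
    rw [listDeriv_cons, hu.integral_mul_pderiv (contDiff_listDeriv hχ l), ih (hu.pderiv i),
      -- Parts are taken from the outermost direction, which lands innermost on `u`; the permutation
      -- restores the order.
      listDeriv_perm (l := i :: l) (l' := l ++ [i]) hu.1 (List.perm_append_singleton i l).symm,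
      listDeriv_append, List.length_cons, pow_succ]
    simp

lemma IsTest.hasWeakDeriv {u : Chart m → ℝ} (hu : IsTest m δ u) (ν : Fin (m + 2) → ℕ) :
    HasWeakDeriv m δ ν u (NeckEstimate.multiDeriv ν u) := by
  refine ⟨hu.continuous.locallyIntegrable.locallyIntegrableOn _,
    (hu.multiDeriv ν).continuous.locallyIntegrable.locallyIntegrableOn _, fun χ hχ => ?_⟩
  rw [(hu.mul (hχ.multiDeriv ν)).setIntegral_eq, ((hu.multiDeriv ν).mul hχ).setIntegral_eq,
    multiDeriv_eq_listDeriv, multiDeriv_eq_listDeriv, hu.integral_mul_listDeriv hχ.1,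
    length_dirList]

/-! ### The metric in coordinates -/

lemma pderiv_graph {p : Chart m} (hp : radSq p ≠ 0) (k i : Fin (m + 2)) :
    pderiv i (fun q : Chart m => δ ^ 2 * q k / (2 * (q 0 ^ 2 + q 1 ^ 2))) p
      = δ ^ 2 / 2 * (-(radSq p ^ 2)⁻¹ * pderiv i radSq p * p k
        + (radSq p)⁻¹ * (if i = k then 1 else 0)) := by
  have h := (contDiffAt_inv_radSq_pow hp 1).differentiableAt (by simp)
  have hc : DifferentiableAt ℝ (fun q : Chart m => q k) p :=
    differentiableAt_of_smooth (contDiff_coord k) p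
  have e : (fun q : Chart m => δ ^ 2 * q k / (2 * (q 0 ^ 2 + q 1 ^ 2)))
      = fun q => δ ^ 2 / 2 * ((radSq q ^ 1)⁻¹ * q k) := by
    ext q
    rw [show q 0 ^ 2 + q 1 ^ 2 = radSq q from rfl, pow_one, div_eq_mul_inv, mul_inv]
    ring
  rw [e, pderiv_const_mul_apply (h.fun_mul hc), pderiv_mul_apply h hc,
    pderiv_inv_radSq_pow hp 0, pderiv_coord]
  simp

/-- The map `(x, y) ↦ (u, v)` is a scaled inversion in a circle, hence angle-preserving, so `du² +
dv²` pulls back to a multiple of `dx² + dy²`. -/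
lemma metric_eq_diagonal (hδ : 0 < δ) {p : Chart m} (hp : p ∈ neck m δ) :
    metric m δ p
      = Matrix.diagonal fun j => if j = 0 ∨ j = 1 then conf m δ p else 1 := by
  have hr := (radSq_pos hδ hp).ne'
  have hs : radSq p = p 0 ^ 2 + p 1 ^ 2 := rfl
  have hU (i : Fin (m + 2)) := pderiv_graph (δ := δ) hr 0 i
  have hV (i : Fin (m + 2)) := pderiv_graph (δ := δ) hr 1 i
  have h01 : (0 : Fin (m + 2)) ≠ 1 := by simp
  ext i j
  simp only [metric, Matrix.of_apply, Matrix.diagonal_apply, conf]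
  unfold graphU graphV
  rw [hU, hU, hV, hV]
  simp only [pderiv_radSq]
  by_cases hi : i = 0 ∨ i = 1
  · by_cases hj : j = 0 ∨ j = 1
    · rcases hi with rfl | rfl <;> rcases hj with rfl | rfl <;>
        simp only [if_true, if_false, h01, h01.symm, true_or, or_true, mul_one, mul_zero, add_zero,
          zero_add] <;> field_simp <;> rw [hs] <;> ring
    · have hij : i ≠ j := by rintro rfl; exact hj hi
      rw [not_or] at hj
      simp [hij, hj]
  · rw [not_or] at hi
    simp [hi]

lemma volDensity_eq (hδ : 0 < δ) {p : Chart m} (hp : p ∈ neck m δ) :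
    volDensity m δ p = conf m δ p := by
  have h := (conf_bounds hδ hp).1
  rw [volDensity, metric_eq_diagonal hδ hp, Matrix.det_diagonal, Fin.prod_univ_succ,
    Fin.prod_univ_succ, show (Fin.succ 0 : Fin (m + 2)) = 1 from rfl]
  simp only [succ_succ_ne, true_or, or_true, if_true, if_false, Finset.prod_const_one, mul_one]
  exact Real.sqrt_mul_self (by linarith)

/-- The Dirichlet form is conformally invariant in two dimensions: the diagonal entry is `1` in the
`x, y` directions and `conf` in the `κ` directions. -/
lemma volDensity_mul_inv_metric (hδ : 0 < δ) {p : Chart m} (hp : p ∈ neck m δ)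
    (j k : Fin (m + 2)) :
    volDensity m δ p * (metric m δ p)⁻¹ j k
      = if j = k then conf m δ p * coeff m δ j p else 0 := by
  have h : (metric m δ p)⁻¹ = Matrix.diagonal fun j => coeff m δ j p := by
    refine Matrix.inv_eq_right_inv ?_
    rw [metric_eq_diagonal hδ hp, Matrix.diagonal_mul_diagonal, ← Matrix.diagonal_one]
    congr 1
    ext i
    by_cases hi : i = 0 ∨ i = 1
    · simp only [coeff, hi, if_true, conf_mul_invConf (radSq_pos hδ hp)]
    · simp only [coeff, hi, if_false, mul_one]
  rw [h, volDensity_eq hδ hp, Matrix.diagonal_apply]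
  split_ifs <;> simp

lemma leb_le_dvol (hδ : 0 < δ) : leb m δ ≤ dvol m δ := by
  have h := withDensity_mono (μ := leb m δ) (f := fun _ => (1 : ℝ≥0∞))
    (g := fun p => ENNReal.ofReal (volDensity m δ p)) (by
      filter_upwards [ae_restrict_mem (isOpen_neck m δ).measurableSet] with p hp
      rw [volDensity_eq hδ hp, ← ENNReal.ofReal_one]
      exact ENNReal.ofReal_le_ofReal (conf_bounds hδ hp).1)
  rwa [withDensity_const, one_smul] at h

lemma dvol_le_leb (hδ : 0 < δ) : dvol m δ ≤ (2 : ℝ≥0∞) • leb m δ := by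
  rw [← withDensity_const]
  refine withDensity_mono ?_
  filter_upwards [ae_restrict_mem (isOpen_neck m δ).measurableSet] with p hp
  rw [volDensity_eq hδ hp]
  refine (ENNReal.ofReal_le_ofReal ((conf_bounds hδ hp).2.trans (by norm_num : (5 / 4 : ℝ) ≤ 2))).trans ?_
  simp

/-! ### Sobolev norms through Lebesgue measure -/

lemma eLpNorm_two_sq (g : Chart m → ℝ) (μ : Measure (Chart m)) :
    eLpNorm g 2 μ ^ 2 = ∫⁻ p, ‖g p‖ₑ ^ 2 ∂μ := by
  have h := eLpNorm_nnreal_pow_eq_lintegral (f := g) (μ := μ) (p := 2) (by norm_num)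
  simpa using h

lemma sq_rpow_half (a : ℝ≥0∞) : (a ^ 2) ^ (1 / 2 : ℝ) = a := by
  rw [← ENNReal.rpow_natCast, ← ENNReal.rpow_mul]
  norm_num

lemma eLpNorm_weakDeriv_le_sobolevNorm (hδ : 0 < δ) {k : ℕ} {ν : Fin (m + 2) → ℕ}
    (hν : ν ∈ multiIndices m k) (f : Chart m → ℝ) :
    eLpNorm (weakDeriv m δ ν f) 2 (leb m δ) ≤ sobolevNorm m δ k f := by
  rw [← sq_rpow_half (eLpNorm _ _ _), eLpNorm_two_sq]
  refine ENNReal.rpow_le_rpow ?_ (by norm_num)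
  refine (lintegral_mono' (leb_le_dvol hδ) le_rfl).trans ?_
  exact Finset.single_le_sum (f := fun ν => ∫⁻ p, ‖weakDeriv m δ ν f p‖ₑ ^ 2 ∂(dvol m δ))
    (fun _ _ => zero_le) hν

/-- The factor `2` comes from `dvol_le_leb`, the cardinality from bounding each multi-index
separately; neither involves `δ`. -/
lemma sobolevNorm_le (hδ : 0 < δ) {k : ℕ} {f : Chart m → ℝ} {K : ℝ≥0∞}
    (h : ∀ ν ∈ multiIndices m k, eLpNorm (weakDeriv m δ ν f) 2 (leb m δ) ≤ K) :
    sobolevNorm m δ k f ≤ (2 * (multiIndices m k).card : ℝ≥0∞) ^ (1 / 2 : ℝ) * K := by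
  rw [← sq_rpow_half K, ← ENNReal.mul_rpow_of_nonneg _ _ (by norm_num)]
  refine ENNReal.rpow_le_rpow ?_ (by norm_num)
  rw [mul_comm 2, mul_assoc, ← nsmul_eq_mul]
  refine Finset.sum_le_card_nsmul _ _ _ fun ν hν => ?_
  refine (lintegral_mono' (dvol_le_leb hδ) le_rfl).trans ?_
  rw [lintegral_smul_measure, ← eLpNorm_two_sq, smul_eq_mul]
  gcongr
  exact h ν hν

lemma IsTest.eLpNorm_eq {u : Chart m → ℝ} (hu : IsTest m δ u) :
    eLpNorm u 2 (leb m δ) = ENNReal.ofReal (Real.sqrt (sqNorm u)) := by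
  have h : eLpNorm u 2 (leb m δ) ^ 2 = ENNReal.ofReal (sqNorm u) := by
    rw [eLpNorm_two_sq, sqNorm, ← hu.sq.setIntegral_eq,
      ofReal_integral_eq_lintegral_ofReal hu.sq.integrable.integrableOn
        (Filter.Eventually.of_forall fun _ => sq_nonneg _)]
    refine lintegral_congr fun p => ?_
    rw [← sq_abs, ENNReal.ofReal_pow (abs_nonneg _), ← Real.norm_eq_abs, ofReal_norm]
  rw [← sq_rpow_half (eLpNorm _ _ _), h, ENNReal.ofReal_rpow_of_nonneg (sqNorm_nonneg _)
    (by norm_num), Real.sqrt_eq_rpow]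

lemma eLpNorm_le_of_sqNorm_le {u v : Chart m → ℝ} (hu : IsTest m δ u) (hv : IsTest m δ v) {C : ℝ}
    (hC : 0 ≤ C) {k : ℕ} (h : sqNorm u ≤ C * sobSq k v) :
    eLpNorm u 2 (leb m δ)
      ≤ ENNReal.ofReal (Real.sqrt C)
        * ∑ ν ∈ multiIndices m k, eLpNorm (multiDeriv ν v) 2 (leb m δ) := by
  rw [hu.eLpNorm_eq, Finset.sum_congr rfl fun ν _ => (hv.multiDeriv ν).eLpNorm_eq,
    ← ENNReal.ofReal_sum_of_nonneg fun _ _ => Real.sqrt_nonneg _,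
    ← ENNReal.ofReal_mul (Real.sqrt_nonneg _)]
  refine ENNReal.ofReal_le_ofReal ((Real.sqrt_le_sqrt h).trans ?_)
  rw [Real.sqrt_mul hC]
  refine mul_le_mul_of_nonneg_left ?_ (Real.sqrt_nonneg _)
  refine Real.sqrt_le_iff.2 ⟨Finset.sum_nonneg fun _ _ => Real.sqrt_nonneg _, ?_⟩
  refine le_trans (le_of_eq ?_) (Finset.sum_sq_le_sq_sum_of_nonneg fun _ _ => Real.sqrt_nonneg _)
  exact Finset.sum_congr rfl fun ν _ => (Real.sq_sqrt (sqNorm_nonneg _)).symm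

/-! ### Passage to the limit -/

open Filter Topology

lemma MemSobolev.hasWeakDeriv {k : ℕ} {f : Chart m → ℝ} (hf : MemSobolev m δ k f)
    {ν : Fin (m + 2) → ℕ} (hν : ν ∈ multiIndices m k) :
    HasWeakDeriv m δ ν f (weakDeriv m δ ν f) :=
  let ⟨_, h, _⟩ := hf ν hν
  h.weakDeriv

lemma MemSobolev.memLp (hδ : 0 < δ) {k : ℕ} {f : Chart m → ℝ} (hf : MemSobolev m δ k f)
    {ν : Fin (m + 2) → ℕ} (hν : ν ∈ multiIndices m k) :
    MemLp (weakDeriv m δ ν f) 2 (leb m δ) :=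
  let ⟨_, h, h2⟩ := hf ν hν
  (memLp_congr_ae h.weakDeriv_ae_eq).2 (h2.mono_measure (leb_le_dvol hδ))

lemma MemSobolevZero.exists_seq (hδ : 0 < δ) {k : ℕ} {f : Chart m → ℝ}
    (hf : MemSobolevZero m δ k f) :
    ∃ φ : ℕ → Chart m → ℝ, (∀ n, IsTest m δ (φ n)) ∧ ∀ ν ∈ multiIndices m k,
      Tendsto (fun n => eLpNorm (multiDeriv ν (φ n) - weakDeriv m δ ν f) 2 (leb m δ))
        atTop (𝓝 0) := by
  -- At `n = 0` the tolerance is `0⁻¹ = ∞`, so no shift of the index is needed.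
  choose φ hφ hlt using fun n : ℕ => hf.2 (n : ℝ≥0∞)⁻¹ (by simp)
  refine ⟨φ, hφ, fun ν hν => ?_⟩
  refine tendsto_of_tendsto_of_tendsto_of_le_of_le tendsto_const_nhds
    ENNReal.tendsto_inv_nat_nhds_zero (fun _ => zero_le) fun n => ?_
  have h := ((hf.1.hasWeakDeriv hν).sub ((hφ n).hasWeakDeriv ν)).weakDeriv_ae_eq
  dsimp only
  rw [eLpNorm_sub_comm, ← eLpNorm_congr_ae h]
  exact (eLpNorm_weakDeriv_le_sobolevNorm hδ hν _).trans (hlt n).le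

lemma tendsto_integral_mul_of_tendsto_eLpNorm {g : ℕ → Chart m → ℝ} {G χ : Chart m → ℝ}
    {μ : Measure (Chart m)} (hg : ∀ n, MemLp (g n) 2 μ) (hG : MemLp G 2 μ) (hχ : MemLp χ 2 μ)
    (h : Tendsto (fun n => eLpNorm (g n - G) 2 μ) atTop (𝓝 0)) :
    Tendsto (fun n => ∫ p, g n p * χ p ∂μ) atTop (𝓝 (∫ p, G p * χ p ∂μ)) := by
  refine tendsto_integral_of_L1' (fun p => G p * χ p) (hG.integrable_mul hχ).aestronglyMeasurable
    (Eventually.of_forall fun n => (hg n).integrable_mul hχ) ?_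
  have h0 : Tendsto (fun n => eLpNorm (g n - G) 2 μ * eLpNorm χ 2 μ) atTop (𝓝 0) := by
    simpa using ENNReal.Tendsto.mul_const h (Or.inr hχ.eLpNorm_ne_top)
  refine tendsto_of_tendsto_of_tendsto_of_le_of_le tendsto_const_nhds h0 (fun _ => zero_le)
    fun n => ?_
  have e : ((fun p => g n p * χ p) - fun p => G p * χ p) = (g n - G) • χ := by
    ext p; simp [sub_mul]
  dsimp only
  rw [e]
  exact eLpNorm_smul_le_mul_eLpNorm hχ.aestronglyMeasurable ((hg n).sub hG).aestronglyMeasurable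

/-- Completeness of `L²` supplies a limit of the derivatives; pairing with test functions identifies
it with the weak derivative of the distributional limit. -/
lemma tendsto_eLpNorm_multiDeriv {g : ℕ → Chart m → ℝ} (hg : ∀ n, IsTest m δ (g n))
    {ψ D : Chart m → ℝ} {ν : Fin (m + 2) → ℕ} (hψ : HasWeakDeriv m δ ν ψ D)
    (hlim : ∀ χ, IsTest m δ χ → Tendsto (fun n => ∫ p in neck m δ, g n p * χ p) atTop
      (𝓝 (∫ p in neck m δ, ψ p * χ p)))
    (hC : Tendsto (fun n : ℕ × ℕ => eLpNorm (multiDeriv ν (g n.1) - multiDeriv ν (g n.2)) 2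
      (leb m δ)) atTop (𝓝 0)) :
    Tendsto (fun n => eLpNorm (multiDeriv ν (g n) - D) 2 (leb m δ)) atTop (𝓝 0) := by
  have hmem (n : ℕ) : MemLp (multiDeriv ν (g n)) 2 (leb m δ) := ((hg n).multiDeriv ν).memLp _
  have hcau : CauchySeq fun n => (hmem n).toLp (multiDeriv ν (g n)) := by
    rw [Lp.cauchySeq_Lp_iff_cauchySeq_eLpNorm]
    refine hC.congr fun n => eLpNorm_congr_ae ?_
    exact ((hmem n.1).coeFn_toLp.sub (hmem n.2).coeFn_toLp).symm
  obtain ⟨G₀, hG⟩ := cauchySeq_tendsto_of_complete hcau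
  obtain ⟨G, hGm, rfl⟩ : ∃ (G : Chart m → ℝ) (hGm : MemLp G 2 (leb m δ)), hGm.toLp G = G₀ :=
    ⟨G₀, Lp.memLp G₀, Lp.toLp_coeFn _ _⟩
  have hG' : Tendsto (fun n => eLpNorm (multiDeriv ν (g n) - G) 2 (leb m δ)) atTop (𝓝 0) :=
    (Lp.tendsto_Lp_iff_tendsto_eLpNorm'' _ hmem G hGm).1 hG
  have hGD : G =ᵐ[leb m δ] D := by
    refine ae_eq_of_integral_mul_test (locallyIntegrableOn_of_memLp hGm) hψ.2.1 fun χ hχ => ?_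
    have h1 := tendsto_integral_mul_of_tendsto_eLpNorm hmem hGm (hχ.memLp _) hG'
    have h2 := (hlim _ (hχ.multiDeriv ν)).const_mul ((-1 : ℝ) ^ ∑ i, ν i)
    have h3 (n : ℕ) : (-1 : ℝ) ^ (∑ i, ν i) * ∫ p in neck m δ, g n p * multiDeriv ν χ p
        = ∫ p in neck m δ, multiDeriv ν (g n) p * χ p := by
      rw [((hg n).hasWeakDeriv ν).2.2 χ hχ, ← mul_assoc, ← mul_pow]
      simp
    simp only [h3] at h2
    rw [tendsto_nhds_unique h1 h2, hψ.2.2 χ hχ, ← mul_assoc, ← mul_pow]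
    simp
  refine hG'.congr fun n => eLpNorm_congr_ae ?_
  exact (ae_eq_refl _).sub hGD

/-! ### The weak equation with respect to Lebesgue measure -/

lemma multiDeriv_single (j : Fin (m + 2)) {u : Chart m → ℝ} (hu : ContDiff ℝ ∞ u) :
    multiDeriv (Pi.single j 1) u = pderiv j u := by
  have h := listDeriv_eq_multiDeriv hu [j]
  rw [listDeriv_cons, listDeriv_nil] at h
  rw [h]
  congr 1
  ext i
  by_cases hij : i = j
  · subst hij; simp
  · simp [hij, Ne.symm hij]

/-- For `j = 0, 1` the two coefficients multiply to `1`; for the other `j`, `a` passes through `∂ⱼ`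
and cancels `conf`. -/
lemma conf_mul_coeff_mul_pderiv (hδ : 0 < δ) {χ : Chart m → ℝ} (hχ : IsTest m δ χ) {p : Chart m}
    (hp : p ∈ neck m δ) (j : Fin (m + 2)) :
    conf m δ p * coeff m δ j p * pderiv j (fun q => invConf m δ q * χ q) p
      = pderiv j (fun q => coeff m δ j q * χ q) p := by
  have h1 := conf_mul_invConf (δ := δ) (radSq_pos hδ hp)
  have hs (i : Fin m) : i.succ.succ ≠ (0 : Fin (m + 2)) ∧ i.succ.succ ≠ (1 : Fin (m + 2)) :=
    not_or.1 (succ_succ_ne i)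
  by_cases hj : j = 0 ∨ j = 1
  · rw [show coeff m δ j = invConf m δ from funext fun p => if_pos hj, h1, one_mul]
  · obtain ⟨i, rfl⟩ : ∃ i : Fin m, j = i.succ.succ := by
      rw [not_or] at hj
      obtain ⟨i, rfl⟩ := Fin.exists_succ_eq.2 hj.1
      obtain ⟨i, rfl⟩ := Fin.exists_succ_eq.2 (fun h : i = 0 => hj.2 (by rw [h]; rfl))
      exact ⟨i, rfl⟩
    rw [show coeff m δ i.succ.succ = fun _ => 1 from funext fun p => if_neg hj,
      pderiv_dependsOnXY_mul dependsOnXY_invConf (contDiff_invConf hδ) hχ.1]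
    simp only [one_mul, mul_one]
    rw [← mul_assoc, h1, one_mul]

/-- Testing with `a χ` instead of `χ` cancels the volume density `conf`, so the equation can be
compared with `∫ Δ_δ φₙ · χ`. -/
lemma LaplaceEq.integral_mul (hδ : 0 < δ) {f ψ χ : Chart m → ℝ} (h : LaplaceEq m δ f ψ)
    (hχ : IsTest m δ χ) :
    ∫ p in neck m δ, ∑ j, weakDeriv m δ (Pi.single j 1) f p
        * pderiv j (fun q => coeff m δ j q * χ q) p
      = - ∫ p in neck m δ, ψ p * χ p := by
  have h1 := h _ (hχ.smooth_mul (contDiff_invConf hδ))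
  have hm := (isOpen_neck m δ).measurableSet
  rw [setIntegral_congr_fun (f := fun p => volDensity m δ p * ψ p * (invConf m δ p * χ p))
    hm (g := fun p => ψ p * χ p) fun p hp => ?_] at h1
  · rw [← h1]
    refine setIntegral_congr_fun hm fun p hp => Finset.sum_congr rfl fun j _ => ?_
    simp only [volDensity_mul_inv_metric hδ hp, ite_mul, zero_mul, Finset.sum_ite_eq,
      Finset.mem_univ, if_true]
    rw [← conf_mul_coeff_mul_pderiv hδ hχ hp]
    ring
  · have h2 := conf_mul_invConf (δ := δ) (radSq_pos hδ hp)
    simp only [volDensity_eq hδ hp]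
    linear_combination (ψ p * χ p) * h2

lemma IsTest.integral_lapNeck_mul (hδ : 0 < δ) {u χ : Chart m → ℝ} (hu : IsTest m δ u)
    (hχ : IsTest m δ χ) :
    ∫ p in neck m δ, NeckEstimate.lapNeck δ u p * χ p
      = - ∑ j, ∫ p in neck m δ,
        NeckEstimate.pderiv j u p * NeckEstimate.pderiv j (fun q => coeff m δ j q * χ q) p := by
  have ha (j : Fin (m + 2)) := hχ.smooth_mul (contDiff_coeff hδ j)
  have hI (j : Fin (m + 2)) := ((hu.pderiv j).pderiv j).mul (ha j)
  rw [((hu.lapNeck hδ).mul hχ).setIntegral_eq, ← Finset.sum_neg_distrib]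
  have e : (fun p => NeckEstimate.lapNeck δ u p * χ p) = fun p => ∑ j,
      NeckEstimate.pderiv j (NeckEstimate.pderiv j u) p * (coeff m δ j p * χ p) := by
    ext p
    rw [lapNeck_eq_sum, Finset.sum_mul]
    exact Finset.sum_congr rfl fun j _ => by ring
  rw [e, integral_finsetSum _ fun j _ => (hI j).integrable]
  refine Finset.sum_congr rfl fun j _ => ?_
  rw [((hu.pderiv j).mul ((ha j).pderiv j)).setIntegral_eq,
    (hu.pderiv j).integral_mul_pderiv (ha j).1, neg_neg]

/-- A uniform a priori estimate for test functions extends to the closure of the test functions. -/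
lemma sobolevNorm_le_of_test (hδ : 0 < δ) (hδ1 : δ < 1) {k : ℕ} {C : ℝ} (hC0 : 0 ≤ C)
    (hest : ∀ u, IsTest m δ u → ∀ ν ∈ multiIndices m (k + 2),
      sqNorm (multiDeriv ν u) ≤ C * sobSq k (lapNeck δ u))
    {f ψ : Chart m → ℝ} (hf : MemSobolevZero m δ (k + 2) f) (hψ : MemSobolev m δ k ψ)
    (heq : LaplaceEq m δ f ψ) :
    sobolevNorm m δ (k + 2) f ≤ (2 * (multiIndices m (k + 2)).card : ℝ≥0∞) ^ (1 / 2 : ℝ)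
      * (ENNReal.ofReal (Real.sqrt C) * ((multiIndices m k).card * sobolevNorm m δ k ψ)) := by
  obtain ⟨φ, hφ, hlim⟩ := hf.exists_seq hδ
  have hdist : ∀ χ, IsTest m δ χ → Tendsto (fun n => ∫ p in neck m δ, lapNeck δ (φ n) p * χ p)
      atTop (𝓝 (∫ p in neck m δ, ψ p * χ p)) := by
    intro χ hχ
    have ha (j : Fin (m + 2)) := (hχ.smooth_mul (contDiff_coeff hδ j)).pderiv j
    have hj (j : Fin (m + 2)) : Pi.single j 1 ∈ multiIndices m (k + 2) := by
      rw [mem_multiIndices, Finset.sum_pi_single']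
      simp
    have hI (j : Fin (m + 2)) : Integrable (fun p => weakDeriv m δ (Pi.single j 1) f p *
        pderiv j (fun q => coeff m δ j q * χ q) p) (leb m δ) :=
      (hf.1.memLp hδ (hj j)).integrable_mul ((ha j).memLp (leb m δ))
    rw [← neg_neg (∫ p in neck m δ, ψ p * χ p), ← heq.integral_mul hδ hχ,
      integral_finsetSum _ fun j _ => hI j]
    simp only [(hφ _).integral_lapNeck_mul hδ hχ]
    refine (tendsto_finsetSum _ fun j _ => ?_).neg
    refine tendsto_integral_mul_of_tendsto_eLpNorm (fun n => ((hφ n).pderiv j).memLp _)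
      (hf.1.memLp hδ (hj j)) ((ha j).memLp _) ?_
    simpa only [multiDeriv_single j (hφ _).1] using hlim _ (hj j)
  have hψlim : ∀ ν ∈ multiIndices m k,
      Tendsto (fun n => eLpNorm (multiDeriv ν (lapNeck δ (φ n)) - weakDeriv m δ ν ψ) 2 (leb m δ))
        atTop (𝓝 0) := by
    intro ν hν
    refine tendsto_eLpNorm_multiDeriv (fun n => (hφ n).lapNeck hδ) (hψ.hasWeakDeriv hν) hdist ?_
    -- This `K` may depend on `δ`; it is used only to make `Δ_δ φₙ` Cauchy and does not enter the
    -- final constant.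
    obtain ⟨K, hK0, hK⟩ := exists_sqNorm_multiDeriv_lapNeck_le (m := m) hδ hδ1 hν
    have hsub (μ : Fin (m + 2) → ℕ) {u v : Chart m → ℝ} (hu : IsTest m δ u) (hv : IsTest m δ v) :
        multiDeriv μ (fun p => u p - v p) = multiDeriv μ u - multiDeriv μ v := by
      simp only [multiDeriv_eq_listDeriv, listDeriv_sub _ hu.1 hv.1]
      rfl
    have hbound (n : ℕ × ℕ) :
        eLpNorm (multiDeriv ν (lapNeck δ (φ n.1)) - multiDeriv ν (lapNeck δ (φ n.2))) 2 (leb m δ)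
        ≤ ENNReal.ofReal (Real.sqrt K) * ∑ μ ∈ multiIndices m (k + 2),
          (eLpNorm (multiDeriv μ (φ n.1) - weakDeriv m δ μ f) 2 (leb m δ)
            + eLpNorm (multiDeriv μ (φ n.2) - weakDeriv m δ μ f) 2 (leb m δ)) := by
      have hd := (hφ n.1).sub (hφ n.2)
      rw [← hsub ν ((hφ _).lapNeck hδ) ((hφ _).lapNeck hδ), ← lapNeck_sub (hφ _).1 (hφ _).1]
      refine (eLpNorm_le_of_sqNorm_le ((hd.lapNeck hδ).multiDeriv ν) hd hK0 (hK _ hd)).trans ?_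
      gcongr with μ hμ
      rw [hsub μ (hφ _) (hφ _), ← sub_sub_sub_cancel_right _ _ (weakDeriv m δ μ f)]
      have hmem (i : ℕ) : AEStronglyMeasurable (multiDeriv μ (φ i) - weakDeriv m δ μ f)
          (leb m δ) :=
        ((((hφ i).multiDeriv μ).memLp (leb m δ)).sub (hf.1.memLp hδ hμ)).aestronglyMeasurable
      exact eLpNorm_sub_le (hmem _) (hmem _) (by norm_num)
    refine tendsto_of_tendsto_of_tendsto_of_le_of_le tendsto_const_nhds ?_ (fun _ => zero_le)
      hbound
    have hsum : Tendsto (fun n : ℕ × ℕ => ∑ μ ∈ multiIndices m (k + 2),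
          (eLpNorm (multiDeriv μ (φ n.1) - weakDeriv m δ μ f) 2 (leb m δ)
            + eLpNorm (multiDeriv μ (φ n.2) - weakDeriv m δ μ f) 2 (leb m δ))) atTop (𝓝 0) := by
      rw [← prod_atTop_atTop_eq]
      simpa using tendsto_finsetSum _ fun μ hμ =>
        ((hlim μ hμ).comp tendsto_fst).add ((hlim μ hμ).comp tendsto_snd)
    simpa using ENNReal.Tendsto.const_mul hsum (Or.inr ENNReal.ofReal_ne_top)
  refine sobolevNorm_le hδ fun ν hν => ?_
  have hψN : ∑ μ ∈ multiIndices m k, eLpNorm (weakDeriv m δ μ ψ) 2 (leb m δ)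
      ≤ (multiIndices m k).card * sobolevNorm m δ k ψ := by
    rw [← nsmul_eq_mul]
    exact Finset.sum_le_card_nsmul _ _ _ fun μ hμ => eLpNorm_weakDeriv_le_sobolevNorm hδ hμ ψ
  refine le_trans ?_ (mul_le_mul_right hψN _)
  -- The uniform estimate for `φₙ`, with `f` and `ψ` inserted by the triangle inequality; the error
  -- terms vanish as `n → ∞`.
  have hn (n : ℕ) : eLpNorm (weakDeriv m δ ν f) 2 (leb m δ)
      ≤ eLpNorm (multiDeriv ν (φ n) - weakDeriv m δ ν f) 2 (leb m δ)
        + ENNReal.ofReal (Real.sqrt C) * ∑ μ ∈ multiIndices m k,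
          (eLpNorm (multiDeriv μ (lapNeck δ (φ n)) - weakDeriv m δ μ ψ) 2 (leb m δ)
            + eLpNorm (weakDeriv m δ μ ψ) 2 (leb m δ)) := by
    have hm := ((hφ n).multiDeriv ν).memLp (leb m δ)
    have hfm := hf.1.memLp hδ hν
    calc eLpNorm (weakDeriv m δ ν f) 2 (leb m δ)
        = eLpNorm ((weakDeriv m δ ν f - multiDeriv ν (φ n)) + multiDeriv ν (φ n)) 2 (leb m δ) := by
          rw [sub_add_cancel]
      _ ≤ _ := eLpNorm_add_le (hfm.sub hm).aestronglyMeasurable hm.aestronglyMeasurable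
          (by norm_num)
      _ ≤ _ := by
          rw [eLpNorm_sub_comm]
          refine add_le_add_right ((eLpNorm_le_of_sqNorm_le ((hφ n).multiDeriv ν)
            ((hφ n).lapNeck hδ) hC0 (hest _ (hφ n) ν hν)).trans ?_) _
          gcongr with μ hμ
          have h1 := (((hφ n).lapNeck hδ).multiDeriv μ).memLp (leb m δ)
          have h2 := hψ.memLp hδ hμ
          calc _ = eLpNorm ((multiDeriv μ (lapNeck δ (φ n)) - weakDeriv m δ μ ψ)
                + weakDeriv m δ μ ψ) 2 (leb m δ) := by rw [sub_add_cancel]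
            _ ≤ _ := eLpNorm_add_le (h1.sub h2).aestronglyMeasurable h2.aestronglyMeasurable
              (by norm_num)
  refine ge_of_tendsto' (f := fun n => eLpNorm (multiDeriv ν (φ n) - weakDeriv m δ ν f) 2 (leb m δ)
        + ENNReal.ofReal (Real.sqrt C) * ∑ μ ∈ multiIndices m k,
          (eLpNorm (multiDeriv μ (lapNeck δ (φ n)) - weakDeriv m δ μ ψ) 2 (leb m δ)
            + eLpNorm (weakDeriv m δ μ ψ) 2 (leb m δ))) (x := atTop) ?_ hn
  have hsum : Tendsto (fun n => ∑ μ ∈ multiIndices m k,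
          (eLpNorm (multiDeriv μ (lapNeck δ (φ n)) - weakDeriv m δ μ ψ) 2 (leb m δ)
            + eLpNorm (weakDeriv m δ μ ψ) 2 (leb m δ))) atTop
      (𝓝 (∑ μ ∈ multiIndices m k, eLpNorm (weakDeriv m δ μ ψ) 2 (leb m δ))) := by
    refine tendsto_finsetSum _ fun μ hμ => ?_
    simpa using (hψlim μ hμ).add_const (eLpNorm (weakDeriv m δ μ ψ) 2 (leb m δ))
  simpa using (hlim ν hν).add (ENNReal.Tendsto.const_mul hsum (Or.inr ENNReal.ofReal_ne_top))

lemma exists_const_of_test {k : ℕ} {C : ℝ} (hC0 : 0 ≤ C)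
    (hest : ∀ δ : ℝ, 0 < δ → δ < 1 → ∀ u, IsTest m δ u → ∀ ν ∈ multiIndices m (k + 2),
      sqNorm (multiDeriv ν u) ≤ C * sobSq k (lapNeck δ u)) :
    ∃ C : ℝ≥0, ∀ δ : ℝ, 0 < δ → δ < 1 → ∀ f ψ : Chart m → ℝ,
      MemSobolevZero m δ (k + 2) f → MemSobolev m δ k ψ → LaplaceEq m δ f ψ →
        sobolevNorm m δ (k + 2) f ≤ C * sobolevNorm m δ k ψ := by
  have hfin : (2 * (multiIndices m (k + 2)).card : ℝ≥0∞) ^ (1 / 2 : ℝ)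
      * (ENNReal.ofReal (Real.sqrt C) * (multiIndices m k).card) ≠ ⊤ := by
    refine ENNReal.mul_ne_top (ENNReal.rpow_ne_top_of_nonneg (by norm_num) ?_)
      (ENNReal.mul_ne_top ENNReal.ofReal_ne_top (ENNReal.natCast_ne_top _))
    exact ENNReal.mul_ne_top (by norm_num) (ENNReal.natCast_ne_top _)
  lift (2 * (multiIndices m (k + 2)).card : ℝ≥0∞) ^ (1 / 2 : ℝ)
      * (ENNReal.ofReal (Real.sqrt C) * (multiIndices m k).card) to ℝ≥0 using hfin with K hK
  refine ⟨K, fun δ hδ hδ1 f ψ hf hψ heq => ?_⟩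
  rw [hK]
  refine (sobolevNorm_le_of_test hδ hδ1 hC0 (hest δ hδ hδ1) hf hψ heq).trans (le_of_eq ?_)
  ring

end NeckEstimate

end

theorem lemma4p7 (m : ℕ) :
    (∃ C : ℝ≥0, ∀ δ : ℝ, 0 < δ → δ < 1 → ∀ f ψ : NeckEstimate.Chart m → ℝ,
      NeckEstimate.MemSobolevZero m δ 2 f → NeckEstimate.MemSobolev m δ 0 ψ →
      NeckEstimate.LaplaceEq m δ f ψ →
        NeckEstimate.sobolevNorm m δ 2 f ≤ C * NeckEstimate.sobolevNorm m δ 0 ψ) ∧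
    (∃ C : ℝ≥0, ∀ δ : ℝ, 0 < δ → δ < 1 → ∀ f ψ : NeckEstimate.Chart m → ℝ,
      NeckEstimate.MemSobolevZero m δ 4 f → NeckEstimate.MemSobolev m δ 2 ψ →
      NeckEstimate.LaplaceEq m δ f ψ →
        NeckEstimate.sobolevNorm m δ 4 f ≤ C * NeckEstimate.sobolevNorm m δ 2 ψ) :=
  ⟨NeckEstimate.exists_const_of_test (k := 0) (by norm_num) fun _ hδ hδ1 _ hu _ hν =>
      hu.sqNorm_multiDeriv_le_two hδ hδ1 hν,
    NeckEstimate.exists_const_of_test (k := 2) (by positivity) fun _ hδ hδ1 _ hu _ hν =>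
      hu.sqNorm_multiDeriv_le_four hδ hδ1 hν⟩
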